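/- Graphs are finite and may have loops and parallel edges. For a connected graph $G$ let $\beta(G)=|E(G)|-|V(G)|+1$ be its Betti number. For $A\subseteq V(G)$ let $\delta_G(A)$ be the set of edges joining $A$ to $V(G)\setminus A$, and put $\delta_G(H)=\delta_G(V(H))$ for an induced subgraph $H$. A set $B\subseteq E(G)$ is cycle-separating if at least two components of $G-B$ contain cycles. A graph is cyclically $k$-edge-connected if it is connected and no set of fewer than $k$ edges is cycle-separating; the cyclic connectivity $\zeta(G)$ of a connected graph $G$ is the largest integer $k\le\beta(G)$ such that $G$ is cyclically $k$-edge-connected. A graph $G$ is odd-cyclically $4$-connected if every connected induced subgraph $H$ of $G$ such that $\delta_G(H)$ is cycle-separating and $\beta(H)$ is odd satisfies $|\delta_G(H)|\ge 4$. A canonical decomposition of a cubic graph $G$ with $\zeta(G)=3$ is any collection $\{G_1,\dots,G_r\}$ of graphs (its factors) obtained as follows. As long as some graph $K$ of the current collection, which is initially $\{G\}$, is not cyclically $4$-edge-connected, take a $3$-edge-cut $\delta_K(A)$ of $K$ such that $K[A]$ and $K[V(K)\setminus A]$ are connected and have at least two vertices each, and replace $K$ by the two cubic graphs obtained from $K[A]$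 and from $K[V(K)\setminus A]$ by adding to each one new vertex to which the three dangling edges of the cut are attached. The process ends when all graphs of the collection are cyclically $4$-edge-connected. A decycling set of $G$ is a set $J\subseteq V(G)$ such that $G-J$ is acyclic. A stable decycling partition of $G$ is a partition $\{A,J\}$ of $V(G)$ such that $J$ is a decycling set of minimum cardinality, the subgraph induced by $J$ has at most one edge, and $A$ induces a forest with at most two components; it is coherent if $A$ induces a tree. **Theorem.** Let $G$ be an odd-cyclically $4$-connected cubic graph with $\zeta(G)=3$, not isomorphic to $K_4$. Then $G$ has a canonical decomposition, every factor of every canonical decomposition of $G$ has even Betti number, and $G$ itself has even Betti number. In particular, $G$ has a coherent decycling partition $\{A,J\}$ such that $A$ induces a tree and $J$ is independent. -/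

import Mathlib

/-!
Finite multigraphs (loops and parallel edges allowed) are Mathlib's `Graph α β`, with vertex set
`G.vertexSet : Set α` and edge set `G.edgeSet : Set β`.
-/

namespace Graph

universe u v

variable {α : Type u} {β : Type v}

/-! ### Basic notions -/

/-- A graph with finitely many vertices and edges. -/
def IsFinite (G : Graph α β) : Prop := G.vertexSet.Finite ∧ G.edgeSet.Finite

/-- The valency of a vertex; each loop contributes two. -/
noncomputable def valency (G : Graph α β) (x : α) : ℕ∞ :=
  (G.incidenceSet x).encard + (G.loopSet x).encard

/-- Every vertex has valency three. -/
def IsCubic (G : Graph α β) : Prop := ∀ x ∈ G.vertexSet, G.valency x = 3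

/-- Two vertices are joined by a walk. -/
def Reaches (G : Graph α β) (x y : α) : Prop := Relation.ReflTransGen G.Adj x y

/-- Nonempty, and any two vertices are joined by a walk. -/
def IsConnected (G : Graph α β) : Prop :=
  G.vertexSet.Nonempty ∧ ∀ x ∈ G.vertexSet, ∀ y ∈ G.vertexSet, G.Reaches x y

/-- `C` is the vertex set of a connected component of `G`. -/
def IsComponent (G : Graph α β) (C : Set α) : Prop :=
  ∃ x ∈ G.vertexSet, C = {y | G.Reaches x y}

/-- A cycle: a finite connected graph all of whose vertices have valency two. A loop with its
vertex is a cycle of length one, two parallel edges with their ends form one of length two. -/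
def IsCycle (C : Graph α β) : Prop :=
  C.IsFinite ∧ C.IsConnected ∧ ∀ x ∈ C.vertexSet, C.valency x = 2

/-- Some subgraph of `G` is a cycle. -/
def HasCycle (G : Graph α β) : Prop := ∃ C : Graph α β, C ≤ G ∧ C.IsCycle

/-- A forest. -/
def IsForest (G : Graph α β) : Prop := ¬ G.HasCycle

/-- A tree. -/
def IsTree (G : Graph α β) : Prop := G.IsConnected ∧ G.IsForest

/-- The Betti number `|E| - |V| + 1` of a finite connected graph. It is used only for such
graphs. -/
noncomputable def bettiNumber (G : Graph α β) : ℤ :=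
  (G.edgeSet.ncard : ℤ) - (G.vertexSet.ncard : ℤ) + 1

/-- The complete graph on four vertices. -/
def IsK4 (G : Graph α β) : Prop :=
  G.Simple ∧ G.vertexSet.encard = 4 ∧
    ∀ x ∈ G.vertexSet, ∀ y ∈ G.vertexSet, x ≠ y → G.Adj x y

/-! ### Edge cuts and cyclic connectivity -/

/-- The set `δ(A)` of edges that join a vertex in `A` to a vertex not in `A`. -/
def edgeCut (G : Graph α β) (A : Set α) : Set β :=
  {e | ∃ x y, G.IsLink e x y ∧ x ∈ A ∧ y ∉ A}

/-- At least two components of `G - B` contain cycles (in particular `G - B` is disconnected). -/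
def IsCycleSeparating (G : Graph α β) (B : Set β) : Prop :=
  B ⊆ G.edgeSet ∧ ∃ C D : Set α, C ≠ D ∧
    (G.deleteEdges B).IsComponent C ∧ (G.deleteEdges B).IsComponent D ∧
    ((G.deleteEdges B).induce C).HasCycle ∧ ((G.deleteEdges B).induce D).HasCycle

/-- `G` is connected and no set of fewer than `k` edges is cycle-separating. -/
def CyclicallyEdgeConnected (G : Graph α β) (k : ℕ) : Prop :=
  G.IsConnected ∧ ∀ B : Set β, G.IsCycleSeparating B → (k : ℕ∞) ≤ B.encard

/-- The largest integer `k`, not exceeding the Betti number, for which the connected graph `G` is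
cyclically `k`-edge-connected. (The value for a disconnected graph is `0`.) -/
noncomputable def cyclicConnectivity (G : Graph α β) : ℕ :=
  sSup {k : ℕ | (k : ℤ) ≤ G.bettiNumber ∧ G.CyclicallyEdgeConnected k}

/-- Every connected induced subgraph `H` with odd Betti number for which `δ(H)` is
cycle-separating satisfies `|δ(H)| ≥ k`. -/
def OddCyclicallyConnected (G : Graph α β) (k : ℕ) : Prop :=
  ∀ X ⊆ G.vertexSet, (G.induce X).IsConnected → G.IsCycleSeparating (G.edgeCut X) →
    Odd (G.induce X).bettiNumber → (k : ℕ∞) ≤ (G.edgeCut X).encard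

/-! ### Canonical decomposition -/

open Classical in
/-- The graph obtained from `G[A]` by adding a new vertex `x` and attaching to it the dangling
edges, i.e. the edges of `δ(A)`. It is intended for `A ⊂ V(G)` and `x ∉ A`. Its edges are the
edges of `G` that have an end in `A`, and each end of such an edge outside `A` becomes `x`. -/
noncomputable def closeUp (G : Graph α β) (A : Set α) (x : α) : Graph α β :=
  (G.restrict {e | ∃ a ∈ A, G.Inc e a}).map (fun y => if y ∈ A then y else x)

/-- `IsCanonicalDecomposition G L`: the collection `L` results from `G` by repeatedly splitting a
graph along a 3-edge-cut with two nontrivial (connected) sides into the two graphs obtained by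
closing up the sides with a new vertex, until all graphs are cyclically 4-edge-connected. -/
inductive IsCanonicalDecomposition : Graph α β → Multiset (Graph α β) → Prop
  | factor (G : Graph α β) (hG : G.CyclicallyEdgeConnected 4) :
      IsCanonicalDecomposition G {G}
  | split (G : Graph α β) (A B : Set α) (x y : α) (L M : Multiset (Graph α β))
      (hV : A ∪ B = G.vertexSet) (hAB : Disjoint A B)
      (hA : (G.induce A).IsConnected) (hB : (G.induce B).IsConnected)
      (hA' : A.Nontrivial) (hB' : B.Nontrivial)
      (hcut : (G.edgeCut A).encard = 3) (hx : x ∉ A) (hy : y ∉ B)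
      (hL : IsCanonicalDecomposition (G.closeUp A x) L)
      (hM : IsCanonicalDecomposition (G.closeUp B y) M) :
      IsCanonicalDecomposition G (L + M)

/-! ### Decycling partitions -/

/-- Deleting the vertex set `J` eliminates all cycles. -/
def IsDecyclingSet (G : Graph α β) (J : Set α) : Prop :=
  J ⊆ G.vertexSet ∧ (G.deleteVerts J).IsForest

/-- A decycling set of minimum cardinality. -/
def IsMinimumDecyclingSet (G : Graph α β) (J : Set α) : Prop :=
  G.IsDecyclingSet J ∧ ∀ J' : Set α, G.IsDecyclingSet J' → J.encard ≤ J'.encard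

/-- No edge of `G` has both ends in `J`. -/
def IsIndependent (G : Graph α β) (J : Set α) : Prop := (G.induce J).edgeSet = ∅

/-- `J` induces a subgraph with exactly one edge. -/
def IsNearIndependent (G : Graph α β) (J : Set α) : Prop := (G.induce J).edgeSet.encard = 1

/-- `{A, J}` is a partition of the vertex set where `J` is a minimum decycling set which is
independent or near-independent and `A` induces a forest with at most two components. -/
def IsStableDecyclingPartition (G : Graph α β) (A J : Set α) : Prop :=
  A ∪ J = G.vertexSet ∧ Disjoint A J ∧ A.Nonempty ∧ J.Nonempty ∧
    G.IsMinimumDecyclingSet J ∧ (G.IsIndependent J ∨ G.IsNearIndependent J) ∧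
    (G.induce A).IsForest ∧ {C : Set α | (G.induce A).IsComponent C}.encard ≤ 2

/-- A stable decycling partition `{A, J}` such that `A` induces a tree. -/
def IsCoherentDecyclingPartition (G : Graph α β) (A J : Set α) : Prop :=
  G.IsStableDecyclingPartition A J ∧ (G.induce A).IsTree

end Graph

/-! In a cubic graph, `2 e(X) + |δ(X)| = 3 |X|` for every vertex set `X`. Hence a connected side `X`
of a 3-edge-cut has Betti number `(|X| - 1) / 2`, and the whole graph has Betti number `|V| / 2 +
1`. The hypotheses exclude edge cuts of size below three and make both sides of every 3-edge-cut
have order 1 modulo 4. A nontrivial 3-edge-cut exists because `K₄` is excluded, so `|V|` is 2 modulo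
4. These properties form `IsEvenCubic`. They pass to both graphs of a split (`IsEvenCubic.closeUp`),
hence to all factors, and they contain the parity claims.

For the decycling partition, fix a root `r` and orient `G` so that every vertex is reachable from
`r`, the in-degree of `r` is even and all other in-degrees are odd. In-degrees other than that of
`r` are then 1 or 3. The vertices of in-degree 3 are sinks, hence pairwise nonadjacent. If `r` has
in-degree 0, let `J` be the set of sinks; otherwise `r` has a single outgoing edge, and `r` is put
into `J` and replaced as root by the head of that edge. Off `J` every vertex except the root is
entered exactly once and is reached from the root, so an arborescence remains. An independent `J`
whose complement is a tree attains the lower bound `4 |J| ≥ |V| + 2` valid for all decycling sets.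

The orientation comes from the theorem of Frank, Jordán and Szigeti (`exists_parityOrientation`). A
class `X` of a vertex partition must contain the heads of at least `demand X` edges: all edges
inside `X`, one more if the root is outside, and a further one if parity requires it. The theorem
says that it suffices that the demands of each partition sum to at most `|E|`. In an even cubic
graph this holds class by class, since `2 * demand X ≤ 3 |X|`; the residue 1 modulo 4 is what saves
the classes with a cut of size three. -/

namespace Graph

/-! ### Demands, prescribed in-degrees and arborescences -/

section Orientation

open Finset

variable {ι α β : Type*}

/-- The number of edges in `E` with both ends in `X`, where `e` joins `s e` to `t e`. -/
noncomputable def innerCard (s t : β → α) (E : Finset β) (X : Finset α) : ℕ := by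
  classical exact #{e ∈ E | s e ∈ X ∧ t e ∈ X}

/-- The least number with the parity of `∑ v ∈ X, τ v` that is at least `innerCard s t E X`, and
greater than it if the root `r` is not in `X`. -/
noncomputable def demand (s t : β → α) (E : Finset β) (τ : α → ℕ) (r : α) (X : Finset α) : ℕ := by
  classical exact innerCard s t E X + (if r ∈ X then 0 else 1) +
    (innerCard s t E X + (if r ∈ X then 0 else 1) + ∑ v ∈ X, τ v) % 2

/-- `P` is a partition of `V` into nonempty classes. -/
def IsVertexPartition (V : Finset α) (P : Finset (Finset α)) : Prop :=
  (∀ X ∈ P, X.Nonempty) ∧ (∀ X ∈ P, ∀ Y ∈ P, ∀ v, v ∈ X → v ∈ Y → X = Y) ∧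
    ∀ v, v ∈ V ↔ ∃ X ∈ P, v ∈ X

/-- An orientation with heads `h` and tails `k` whose in-degrees have the parity of `τ` and in
which every nonempty vertex set avoiding the root `r` is entered by an edge. -/
def IsParityOrientation (s t : β → α) (V : Finset α) (E : Finset β) (τ : α → ℕ) (r : α)
    (h k : β → α) : Prop :=
  (∀ e ∈ E, (h e = s e ∧ k e = t e) ∨ (h e = t e ∧ k e = s e)) ∧
  (∀ v ∈ V, Set.ncard {e | e ∈ E ∧ h e = v} % 2 = τ v % 2) ∧
  ∀ Z ⊆ V, Z.Nonempty → r ∉ Z → ∃ e ∈ E, h e ∈ Z ∧ k e ∉ Z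

/-- The minimality of `demand`; upper bounds that need the parity of a demand go through it. -/
theorem demand_le {s t : β → α} {E : Finset β} {τ : α → ℕ} {r : α} {X : Finset α} {m : ℕ}
    (h : innerCard s t E X ≤ m) (h' : r ∉ X → innerCard s t E X + 1 ≤ m)
    (hm : m % 2 = (∑ v ∈ X, τ v) % 2) : demand s t E τ r X ≤ m := by
  unfold demand
  split_ifs with hr
  · omega
  · have := h' hr
    omega

theorem demand_mod (s t : β → α) (E : Finset β) (τ : α → ℕ) (r : α) (X : Finset α) :
    demand s t E τ r X % 2 = (∑ v ∈ X, τ v) % 2 := by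
  unfold demand
  omega

theorem innerCard_le_demand (s t : β → α) (E : Finset β) (τ : α → ℕ) (r : α) (X : Finset α) :
    innerCard s t E X ≤ demand s t E τ r X := by
  unfold demand
  omega

theorem innerCard_lt_demand (s t : β → α) (E : Finset β) (τ : α → ℕ) {r : α} {X : Finset α}
    (hr : r ∉ X) : innerCard s t E X + 1 ≤ demand s t E τ r X := by
  unfold demand
  simp only [hr, if_false]
  omega

theorem demand_le_of_mem (s t : β → α) (E : Finset β) (τ : α → ℕ) {r : α} {X : Finset α}
    (hr : r ∈ X) : demand s t E τ r X ≤ innerCard s t E X + 1 := by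
  unfold demand
  simp only [hr, if_true]
  omega

theorem demand_le_add_two (s t : β → α) (E : Finset β) (τ : α → ℕ) (r : α) (X : Finset α) :
    demand s t E τ r X ≤ innerCard s t E X + 2 := by
  unfold demand
  split_ifs <;> omega

theorem innerCard_mono (s t : β → α) {E E' : Finset β} (h : E ⊆ E') (X : Finset α) :
    innerCard s t E X ≤ innerCard s t E' X := by
  classical
  unfold innerCard
  exact card_le_card (filter_subset_filter _ h)

/-- Hakimi's theorem: an orientation with prescribed in-degrees. -/
theorem exists_head_of_prescribed_indegree [DecidableEq ι] (a b : β → ι) (E : Finset β)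
    (P : Finset ι) (m : ι → ℕ) (hP : ∀ e ∈ E, a e ∈ P ∧ b e ∈ P) (hm : #E = ∑ i ∈ P, m i)
    (hZ : ∀ Z ⊆ P, #{e ∈ E | a e ∈ Z ∧ b e ∈ Z} ≤ ∑ i ∈ Z, m i) :
    ∃ h : β → ι, (∀ e ∈ E, h e = a e ∨ h e = b e) ∧ ∀ i ∈ P, #{e ∈ E | h e = i} = m i := by
  classical
  -- Vertex `i` offers `m i` slots, and each edge must occupy a slot at one of its ends. Hall's
  -- condition holds because a set of edges with end set `Z` lies inside `Z`.
  let slots : E → Finset (ι × ℕ) := fun e =>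
    ({a e.1, b e.1} : Finset ι).biUnion fun i => (range (m i)).image fun n => (i, n)
  have hall : ∀ F : Finset E, #F ≤ #(F.biUnion slots) := by
    intro F
    set Z : Finset ι := F.biUnion fun e => {a e.1, b e.1} with hZdef
    have hZP : Z ⊆ P := by
      intro i hi
      simp only [hZdef, mem_biUnion, mem_insert, mem_singleton] at hi
      obtain ⟨e, -, rfl | rfl⟩ := hi
      exacts [(hP _ e.2).1, (hP _ e.2).2]
    have h1 : F.biUnion slots =
        (Z.sigma fun i => range (m i)).image fun p : (_ : ι) × ℕ => (p.1, p.2) := by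
      ext ⟨i, n⟩
      simp only [slots, hZdef, mem_biUnion, mem_image, mem_sigma, mem_range, Prod.mk.injEq]
      constructor
      · rintro ⟨e, he, j, hj, k, hk, rfl, rfl⟩
        exact ⟨⟨j, k⟩, ⟨⟨e, he, hj⟩, hk⟩, rfl, rfl⟩
      · rintro ⟨⟨j, k⟩, ⟨⟨e, he, hj⟩, hk⟩, rfl, rfl⟩
        exact ⟨e, he, j, hj, k, hk, rfl, rfl⟩
    have h2 : #(F.biUnion slots) = ∑ i ∈ Z, m i := by
      rw [h1, card_image_of_injective, card_sigma]
      · simp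
      · rintro ⟨i, n⟩ ⟨j, k⟩ h
        simpa using h
    rw [h2]
    refine le_trans ?_ (hZ Z hZP)
    rw [← card_map (Function.Embedding.subtype _)]
    refine card_le_card fun e he => ?_
    simp only [mem_map, Function.Embedding.coe_subtype] at he
    obtain ⟨e, he, rfl⟩ := he
    refine mem_filter.2 ⟨e.2, ?_, ?_⟩ <;>
      exact mem_biUnion.2 ⟨e, he, by simp⟩
  obtain ⟨f, hfinj, hf⟩ := (Finset.all_card_le_biUnion_card_iff_exists_injective slots).1 hall
  have hf1 : ∀ e : E, ((f e).1 = a e.1 ∨ (f e).1 = b e.1) ∧ (f e).2 < m (f e).1 := by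
    intro e
    have := hf e
    simp only [slots, mem_biUnion, mem_insert, mem_singleton, mem_image, mem_range] at this
    obtain ⟨i, hi, n, hn, h⟩ := this
    rw [← h]
    exact ⟨hi, hn⟩
  let h : β → ι := fun e => if he : e ∈ E then (f ⟨e, he⟩).1 else a e
  have hle : ∀ i ∈ P, #{e ∈ E | h e = i} ≤ m i := by
    intro i _
    rw [← card_range (m i)]
    refine card_le_card_of_injOn (fun e => if he : e ∈ E then (f ⟨e, he⟩).2 else 0) ?_ ?_
    · intro e he
      obtain ⟨heE, hei⟩ := mem_filter.1 (mem_coe.1 he)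
      have := (hf1 ⟨e, heE⟩).2
      simp only [h, heE, dif_pos] at hei
      simpa [heE, hei] using this
    · intro e he e' he' hee
      obtain ⟨he, h1⟩ := mem_filter.1 (mem_coe.1 he)
      obtain ⟨he', h2⟩ := mem_filter.1 (mem_coe.1 he')
      simp only [h, he, he', dif_pos] at h1 h2 hee
      have := hfinj (Prod.ext (h1.trans h2.symm) hee)
      simpa using this
  have hmem : ∀ e ∈ E, h e = a e ∨ h e = b e := by
    intro e he
    simpa [h, he] using (hf1 ⟨e, he⟩).1
  refine ⟨h, hmem, ?_⟩
  -- Injectivity only bounds each in-degree by `m i`; the equal totals turn all these bounds into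
  -- equalities.
  have hsum : ∑ i ∈ P, #{e ∈ E | h e = i} = ∑ i ∈ P, m i := by
    rw [← hm, ← card_eq_sum_card_fiberwise]
    intro e he
    rcases hmem e he with h1 | h1
    · rw [h1]; exact (hP e he).1
    · rw [h1]; exact (hP e he).2
  exact (sum_eq_sum_iff_of_le hle).1 hsum

/-- A spanning arborescence of a digraph in which every nonempty vertex set avoiding the root is
entered by an edge. -/
theorem exists_arborescence [Nonempty β] (hd tl : β → ι) (E : Finset β) (P : Finset ι) {R : ι}
    (hR : R ∈ P) (htl : ∀ e ∈ E, tl e ∈ P)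
    (hcut : ∀ Z ⊆ P, Z.Nonempty → R ∉ Z → ∃ e ∈ E, hd e ∈ Z ∧ tl e ∉ Z) :
    ∃ (rank : ι → ℕ) (f : ι → β), ∀ i ∈ P, i ≠ R →
      f i ∈ E ∧ hd (f i) = i ∧ rank (tl (f i)) < rank i := by
  classical
  obtain ⟨e₀⟩ := ‹Nonempty β›
  -- The arborescence grows from `{R}`: an edge entering `P \ S` starts in `S`, and its head is
  -- added with rank one above that of its tail.
  suffices H : ∀ n, ∀ S ⊆ P, #(P \ S) = n → R ∈ S → ∀ (rank : ι → ℕ) (f : ι → β),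
      (∀ i ∈ S, i ≠ R → f i ∈ E ∧ hd (f i) = i ∧ tl (f i) ∈ S ∧ rank (tl (f i)) < rank i) →
      ∃ (rank : ι → ℕ) (f : ι → β), ∀ i ∈ P, i ≠ R →
        f i ∈ E ∧ hd (f i) = i ∧ rank (tl (f i)) < rank i by
    refine H _ {R} (by simpa using hR) rfl (by simp) (fun _ => 0) (fun _ => e₀) ?_
    intro i hi hne
    exact absurd (mem_singleton.1 hi) hne
  intro n
  induction n with
  | zero =>
    intro S hS hn _ rank f hf
    refine ⟨rank, f, fun i hi hne => ?_⟩
    rw [card_eq_zero, sdiff_eq_empty_iff_subset] at hn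
    obtain ⟨h1, h2, -, h3⟩ := hf i (hn hi) hne
    exact ⟨h1, h2, h3⟩
  | succ n ih =>
    intro S hS hn hRS rank f hf
    obtain ⟨e, heE, he, he'⟩ := hcut (P \ S) sdiff_subset (card_pos.1 (by omega)) (by simp [hRS])
    have heS : tl e ∈ S := by
      by_contra h
      exact he' (mem_sdiff.2 ⟨htl e heE, h⟩)
    obtain ⟨heP, heS'⟩ := mem_sdiff.1 he
    refine ih (insert (hd e) S) (insert_subset heP hS) ?_ (mem_insert_of_mem hRS)
      (Function.update rank (hd e) (rank (tl e) + 1)) (Function.update f (hd e) e) ?_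
    · have : P \ insert (hd e) S = (P \ S).erase (hd e) := by
        ext i; simp only [mem_sdiff, mem_insert, mem_erase]; tauto
      rw [this, card_erase_of_mem he, hn]; rfl
    · intro i hi hne
      by_cases hie : i = hd e
      · subst hie
        have : tl e ≠ hd e := fun h => heS' (h ▸ heS)
        simp [Function.update_of_ne this, heE, heS]
      · have hiS : i ∈ S := (mem_insert.1 hi).resolve_left hie
        obtain ⟨h1, h2, h3, h4⟩ := hf i hiS hne
        have : tl (f i) ≠ hd e := fun h => heS' (h ▸ h3)
        simp only [Function.update_of_ne hie, Function.update_of_ne this]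
        exact ⟨h1, h2, mem_insert_of_mem h3, h4⟩

end Orientation

end Graph

namespace Graph

/-! ### Vertex partitions and their demands -/

section Orientation

open Finset

variable {α β : Type*}

theorem innerCard_eq [DecidableEq α] (s t : β → α) (E : Finset β) (X : Finset α) :
    innerCard s t E X = #{e ∈ E | s e ∈ X ∧ t e ∈ X} := by
  unfold innerCard
  congr!

theorem ncard_setOf_mem_and [DecidableEq α] (E : Finset β) (h : β → α) (v : α) :
    Set.ncard {e | e ∈ E ∧ h e = v} = #{e ∈ E | h e = v} := by
  rw [← Set.ncard_coe_finset]
  simp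

namespace IsVertexPartition

variable {V : Finset α} {P : Finset (Finset α)}

theorem subset (hP : IsVertexPartition V P) {X : Finset α} (hX : X ∈ P) : X ⊆ V :=
  fun _ hv => (hP.2.2 _).2 ⟨X, hX, hv⟩

theorem pairwiseDisjoint (hP : IsVertexPartition V P) :
    (P : Set (Finset α)).PairwiseDisjoint id := by
  intro X hX Y hY hne
  rw [Function.onFun, Finset.disjoint_left]
  intro v hv hv'
  exact hne (hP.2.1 X hX Y hY v hv hv')

theorem sum_sum (hP : IsVertexPartition V P) (g : α → ℕ) :
    ∑ X ∈ P, ∑ v ∈ X, g v = ∑ v ∈ V, g v := by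
  classical
  have : V = P.biUnion id := by
    ext v
    simp [hP.2.2 v]
  rw [this, sum_biUnion hP.pairwiseDisjoint]
  rfl

theorem eq_singleton (hP : IsVertexPartition V P) (hV : V.Nonempty) (h : #P ≤ 1) : P = {V} := by
  obtain ⟨v, hv⟩ := hV
  obtain ⟨X, hX, -⟩ := (hP.2.2 v).1 hv
  have hPX : P = {X} := by
    refine eq_singleton_iff_unique_mem.2 ⟨hX, fun Y hY => ?_⟩
    exact card_le_one.1 h Y hY X hX
  have : V = X := by
    ext w
    rw [hP.2.2 w, hPX]
    simp
  rw [hPX, this]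

theorem image_singleton [DecidableEq α] (V : Finset α) :
    IsVertexPartition V (V.image fun v => {v}) := by
  refine ⟨?_, ?_, fun v => by simp⟩
  · intro X hX
    obtain ⟨v, -, rfl⟩ := mem_image.1 hX
    simp
  · intro X hX Y hY v hv hv'
    obtain ⟨x, -, rfl⟩ := mem_image.1 hX
    obtain ⟨y, -, rfl⟩ := mem_image.1 hY
    rw [mem_singleton] at hv hv'
    rw [← hv, ← hv']

/-- Splitting one class of a tight partition with the most classes yields a partition that cannot be
tight; this provides slack inside the class. -/
theorem refine_class [DecidableEq α] (hP : IsVertexPartition V P) {X : Finset α} (hX : X ∈ P)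
    {Q : Finset (Finset α)} (hQ : IsVertexPartition X Q) :
    IsVertexPartition V (P.erase X ∪ Q) ∧ Disjoint (P.erase X) Q := by
  have key : ∀ Y ∈ P.erase X, ∀ Z ∈ Q, ∀ v, v ∈ Y → v ∈ Z → False := by
    intro Y hY Z hZ v hv hv'
    obtain ⟨hne, hYP⟩ := mem_erase.1 hY
    exact hne (hP.2.1 Y hYP X hX v hv (hQ.subset hZ hv'))
  refine ⟨⟨?_, ?_, ?_⟩, ?_⟩
  · intro Y hY
    rcases mem_union.1 hY with h | h
    exacts [hP.1 Y (mem_of_mem_erase h), hQ.1 Y h]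
  · intro Y hY Z hZ v hv hv'
    rcases mem_union.1 hY with h | h <;> rcases mem_union.1 hZ with h' | h'
    · exact hP.2.1 Y (mem_of_mem_erase h) Z (mem_of_mem_erase h') v hv hv'
    · exact (key Y h Z h' v hv hv').elim
    · exact (key Z h' Y h v hv' hv).elim
    · exact hQ.2.1 Y h Z h' v hv hv'
  · intro v
    constructor
    · intro hv
      obtain ⟨Y, hY, hvY⟩ := (hP.2.2 v).1 hv
      by_cases hYX : Y = X
      · subst hYX
        obtain ⟨Z, hZ, hvZ⟩ := (hQ.2.2 v).1 hvY
        exact ⟨Z, mem_union_right _ hZ, hvZ⟩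
      · exact ⟨Y, mem_union_left _ (mem_erase.2 ⟨hYX, hY⟩), hvY⟩
    · rintro ⟨Y, hY, hvY⟩
      rcases mem_union.1 hY with h | h
      exacts [hP.subset (mem_of_mem_erase h) hvY, hP.subset hX (hQ.subset h hvY)]
  · rw [Finset.disjoint_left]
    intro Y hY hY'
    obtain ⟨v, hv⟩ := hQ.1 Y hY'
    exact key Y hY Y hY' v hv hv

/-- Comparing a tight partition with the result of a merge shows that a union of classes demands no
more than the classes do together. -/
theorem merge [DecidableEq α] (hP : IsVertexPartition V P) {Z : Finset (Finset α)} (hZ : Z ⊆ P)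
    (hne : Z.Nonempty) :
    IsVertexPartition V (insert (Z.biUnion id) (P \ Z)) ∧ Z.biUnion id ∉ P \ Z := by
  have key : ∀ Y ∈ P \ Z, ∀ v, v ∈ Y → v ∈ Z.biUnion id → False := by
    intro Y hY v hv hv'
    obtain ⟨hYP, hYZ⟩ := mem_sdiff.1 hY
    obtain ⟨X, hX, hvX⟩ := mem_biUnion.1 hv'
    exact hYZ (hP.2.1 Y hYP X (hZ hX) v hv hvX ▸ hX)
  have hne' : (Z.biUnion id).Nonempty := by
    obtain ⟨X, hX⟩ := hne
    obtain ⟨v, hv⟩ := hP.1 X (hZ hX)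
    exact ⟨v, mem_biUnion.2 ⟨X, hX, hv⟩⟩
  refine ⟨⟨?_, ?_, ?_⟩, ?_⟩
  · intro Y hY
    rcases mem_insert.1 hY with rfl | h
    exacts [hne', hP.1 Y (mem_sdiff.1 h).1]
  · intro Y hY X hX v hv hv'
    rcases mem_insert.1 hY with rfl | h <;> rcases mem_insert.1 hX with rfl | h'
    · rfl
    · exact (key X h' v hv' hv).elim
    · exact (key Y h v hv hv').elim
    · exact hP.2.1 Y (mem_sdiff.1 h).1 X (mem_sdiff.1 h').1 v hv hv'
  · intro v
    constructor
    · intro hv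
      obtain ⟨Y, hY, hvY⟩ := (hP.2.2 v).1 hv
      by_cases hYZ : Y ∈ Z
      · exact ⟨_, mem_insert_self _ _, mem_biUnion.2 ⟨Y, hYZ, hvY⟩⟩
      · exact ⟨Y, mem_insert_of_mem (mem_sdiff.2 ⟨hY, hYZ⟩), hvY⟩
    · rintro ⟨Y, hY, hvY⟩
      rcases mem_insert.1 hY with rfl | h
      · obtain ⟨X, hX, hvX⟩ := mem_biUnion.1 hvY
        exact hP.subset (hZ hX) hvX
      · exact hP.subset (mem_sdiff.1 h).1 hvY
  · intro h
    obtain ⟨v, hv⟩ := hne'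
    exact key _ h v hv hv

/-- The class of each vertex. -/
theorem exists_class (hP : IsVertexPartition V P) :
    ∃ c : α → Finset α, (∀ v ∈ V, c v ∈ P ∧ v ∈ c v) ∧ ∀ X ∈ P, ∀ v, v ∈ X → c v = X := by
  classical
  refine ⟨fun v => if h : ∃ X ∈ P, v ∈ X then h.choose else ∅, ?_, ?_⟩
  · intro v hv
    have h := (hP.2.2 v).1 hv
    simp only [h, dif_pos]
    exact h.choose_spec
  · intro X hX v hv
    have h : ∃ X ∈ P, v ∈ X := ⟨X, hX, hv⟩
    simp only [h, dif_pos]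
    exact hP.2.1 _ h.choose_spec.1 X hX v h.choose_spec.2 hv

end IsVertexPartition

/-- Edges inside a union of classes are inside a class or join two of the classes. -/
theorem innerCard_biUnion [DecidableEq α] {s t : β → α} {E : Finset β} {V : Finset α}
    {P : Finset (Finset α)} {c : α → Finset α} (hc : ∀ v ∈ V, c v ∈ P ∧ v ∈ c v) (hc' : ∀ X ∈ P, ∀ v, v ∈ X → c v = X)
    (hE : ∀ e ∈ E, s e ∈ V ∧ t e ∈ V) {Z : Finset (Finset α)} (hZ : Z ⊆ P) :
    innerCard s t E (Z.biUnion id) =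
      #{e ∈ {e ∈ E | c (s e) ≠ c (t e)} | c (s e) ∈ Z ∧ c (t e) ∈ Z} +
        ∑ X ∈ Z, innerCard s t E X := by
  have hmem : ∀ v ∈ V, v ∈ Z.biUnion id ↔ c v ∈ Z := by
    intro v hv
    rw [mem_biUnion]
    constructor
    · rintro ⟨X, hX, hvX⟩
      rwa [hc' X (hZ hX) v hvX]
    · intro h
      exact ⟨c v, h, (hc v hv).2⟩
  have h1 : innerCard s t E (Z.biUnion id) = #{e ∈ E | c (s e) ∈ Z ∧ c (t e) ∈ Z} := by
    rw [innerCard_eq]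
    congr 1
    refine filter_congr fun e he => ?_
    rw [hmem _ (hE e he).1, hmem _ (hE e he).2]
  have h2 : ∑ X ∈ Z, innerCard s t E X =
      #{e ∈ E | (c (s e) ∈ Z ∧ c (t e) ∈ Z) ∧ ¬ c (s e) ≠ c (t e)} := by
    rw [card_eq_sum_card_fiberwise (f := fun e => c (s e)) (t := Z)]
    · refine sum_congr rfl fun X hX => ?_
      rw [innerCard_eq, filter_filter]
      congr 1
      refine filter_congr fun e he => ?_
      constructor
      · rintro ⟨h, h'⟩
        rw [hc' X (hZ hX) _ h, hc' X (hZ hX) _ h']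
        simp [hX]
      · rintro ⟨⟨-, h⟩, rfl⟩
        rw [not_not] at h
        exact ⟨(hc _ (hE e he).1).2, h ▸ (hc _ (hE e he).2).2⟩
    · intro e he
      exact (mem_filter.1 (mem_coe.1 he)).2.1.1
  rw [h1, h2, ← card_filter_add_card_filter_not (p := fun e => c (s e) ≠ c (t e)), filter_filter,
    filter_filter, filter_filter]
  congr 2
  refine filter_congr fun e _ => ?_
  tauto

theorem innerCard_self {s t : β → α} {E : Finset β} {V : Finset α}
    (hE : ∀ e ∈ E, s e ∈ V ∧ t e ∈ V) : innerCard s t E V = #E := by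
  classical
  rw [innerCard_eq, filter_true_of_mem hE]

theorem sum_demand_mod {V : Finset α} {P : Finset (Finset α)} (hP : IsVertexPartition V P)
    (s t : β → α) (E : Finset β) (τ : α → ℕ) (r : α) :
    (∑ X ∈ P, demand s t E τ r X) % 2 = (∑ v ∈ V, τ v) % 2 := by
  rw [← hP.sum_sum τ, sum_nat_mod, sum_nat_mod P 2 fun X => ∑ v ∈ X, τ v]
  congr 1
  exact sum_congr rfl fun X _ => demand_mod ..

/-- Orient an edge arbitrarily and delete it. -/
theorem exists_parityOrientation_of_erase [DecidableEq α] [DecidableEq β] {s t : β → α}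
    {V : Finset α} {E : Finset β}
    {τ : α → ℕ} {r : α} {e₀ : β} (he₀ : e₀ ∈ E)
    (h : ∃ h k, IsParityOrientation s t V (E.erase e₀)
      (fun v => τ v + if v = t e₀ then 1 else 0) r h k) :
    ∃ h k, IsParityOrientation s t V E τ r h k := by
  obtain ⟨h, k, h1, h2, h3⟩ := h
  refine ⟨Function.update h e₀ (t e₀), Function.update k e₀ (s e₀), ?_, ?_, ?_⟩
  · intro e he
    by_cases hee : e = e₀
    · subst hee; simp
    · simpa [Function.update_of_ne hee] using h1 e (mem_erase.2 ⟨hee, he⟩)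
  · intro v hv
    have h2v := h2 v hv
    rw [ncard_setOf_mem_and] at h2v ⊢
    dsimp only at h2v
    have : #{e ∈ E | Function.update h e₀ (t e₀) e = v} =
        (if v = t e₀ then 1 else 0) + #{e ∈ E.erase e₀ | h e = v} := by
      rw [← insert_erase he₀, filter_insert, erase_insert (notMem_erase _ _)]
      have h4 : {e ∈ E.erase e₀ | Function.update h e₀ (t e₀) e = v} =
          {e ∈ E.erase e₀ | h e = v} := by
        refine filter_congr fun e he => ?_
        rw [Function.update_of_ne (ne_of_mem_erase he)]
      rw [h4]
      by_cases hv : v = t e₀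
      · subst hv
        simp [add_comm]
      · simp [hv, Ne.symm hv]
    omega
  · intro Z hZ hne hr
    obtain ⟨e, he, h4, h5⟩ := h3 Z hZ hne hr
    have hee := ne_of_mem_erase he
    exact ⟨e, mem_of_mem_erase he, by rwa [Function.update_of_ne hee],
      by rwa [Function.update_of_ne hee]⟩

/-- Only the class containing `t e₀` has its parity flipped, and its demand grows by at most one;
deleting the edge raises no number of inner edges. -/
theorem sum_demand_erase_le [DecidableEq α] [DecidableEq β] {s t : β → α} {V : Finset α}
    {E : Finset β} {τ : α → ℕ} {r : α} {e₀ : β}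
    (ht : t e₀ ∈ V) {P : Finset (Finset α)} (hP : IsVertexPartition V P) :
    ∑ X ∈ P, demand s t (E.erase e₀) (fun v => τ v + if v = t e₀ then 1 else 0) r X ≤
      ∑ X ∈ P, demand s t E τ r X + 1 := by
  have h1 : ∑ X ∈ P, ∑ v ∈ X, (if v = t e₀ then 1 else 0) = 1 := by
    rw [hP.sum_sum]
    simp [ht]
  refine (sum_le_sum (g := fun X => demand s t E τ r X + ∑ v ∈ X, if v = t e₀ then 1 else 0)
    fun X _ => demand_le ?_ ?_ ?_).trans (by rw [sum_add_distrib, h1])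
  · have := innerCard_mono s t (erase_subset e₀ E) X
    have := innerCard_le_demand s t E τ r X
    omega
  · intro hr
    have := innerCard_mono s t (erase_subset e₀ E) X
    have := innerCard_lt_demand s t E τ hr
    omega
  · have := demand_mod s t E τ r X
    rw [sum_add_distrib]
    omega

end Orientation

end Graph

namespace Graph

/-! ### The orientation theorem with parity conditions -/

section Orientation

open Finset

variable {α β : Type*}

/-- The demands inside a class `X` of a tight partition, after the edges entering `X` have been
oriented, when `a v` of them enter at `v`. -/
theorem sum_demand_class_le [DecidableEq α] {s t : β → α} {E : Finset β} {τ a : α → ℕ} {r x : α}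
    {X : Finset α} {Q : Finset (Finset α)} (hQ : IsVertexPartition X Q) (hx : x ∈ X)
    (hr : r ∈ X → x = r) (hr' : r ∉ X → 1 ≤ a x)
    (ha : innerCard s t E X + ∑ v ∈ X, a v = demand s t E τ r X)
    (hslack : 2 ≤ #Q → ∑ Y ∈ Q, demand s t E τ r Y + 2 ≤ demand s t E τ r X) :
    ∑ Y ∈ Q, demand s t {e ∈ E | s e ∈ X ∧ t e ∈ X} (fun v => τ v + a v) x Y ≤
      innerCard s t E X := by
  have hinner : ∀ Y ⊆ X, innerCard s t {e ∈ E | s e ∈ X ∧ t e ∈ X} Y = innerCard s t E Y := by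
    intro Y hY
    rw [innerCard_eq, innerCard_eq, filter_filter]
    congr 1
    refine filter_congr fun e _ => ?_
    have := @hY (s e)
    have := @hY (t e)
    tauto
  by_cases hcard : #Q ≤ 1
  -- Modulo 2, `τ(X) + a(X)` is `demand X + a(X) = innerCard X + 2 a(X)`, so the new demand of `X`
  -- is exactly the number of its edges.
  · rw [hQ.eq_singleton ⟨x, hx⟩ hcard, sum_singleton]
    refine demand_le (hinner X (subset_refl X)).le (fun h => absurd hx h) ?_
    have := demand_mod s t E τ r X
    rw [sum_add_distrib]
    omega
  · have hslack := hslack (by omega)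
    -- If `r` is outside `X`, the part containing `x` gains 2: its old demand allowed for an
    -- entering edge that is no longer needed, and `a x ≥ 1`. With the slack 2 from `hslack`, this
    -- offsets a demand of `X` that exceeds its inner edges by up to 2. If `r` is in `X`, the excess
    -- is at most 1 and the slack suffices.
    have key : ∀ Y ∈ Q,
        demand s t {e ∈ E | s e ∈ X ∧ t e ∈ X} (fun v => τ v + a v) x Y +
          (∑ v ∈ Y, if v = x then (if r ∈ X then 0 else 2) else 0) ≤
        demand s t E τ r Y + ∑ v ∈ Y, a v := by
      intro Y hY
      have hYX := hQ.subset hY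
      have h1 := hinner Y hYX
      have h2 := demand_mod s t E τ r Y
      have h3 := innerCard_le_demand s t E τ r Y
      have h4 : r ∉ Y → _ := innerCard_lt_demand s t E τ (r := r) (X := Y)
      by_cases hxY : x ∈ Y
      · by_cases hrX : r ∈ X
        · simp only [hrX, if_true, ite_self, sum_const_zero, add_zero]
          refine demand_le (by omega) (fun h => absurd hxY h) ?_
          rw [sum_add_distrib]
          omega
        · have h5 : a x ≤ ∑ v ∈ Y, a v := single_le_sum (fun _ _ => Nat.zero_le _) hxY
          have h6 := hr' hrX
          have h7 := h4 fun h => hrX (hYX h)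
          have h8 : demand s t {e ∈ E | s e ∈ X ∧ t e ∈ X} (fun v => τ v + a v) x Y ≤
              demand s t E τ r Y + ∑ v ∈ Y, a v - 2 := by
            refine demand_le (by omega) (fun h => absurd hxY h) ?_
            rw [sum_add_distrib]
            omega
          simp only [hrX, if_false, sum_ite_eq', hxY, if_true]
          omega
      · simp only [sum_ite_eq', hxY, if_false, add_zero]
        refine demand_le (by omega) (fun _ => ?_) ?_
        · have := h4 fun h => hxY ((hr (hYX h)).symm ▸ h)
          omega
        · rw [sum_add_distrib]
          omega
    have hsum := sum_le_sum key
    rw [sum_add_distrib, sum_add_distrib, hQ.sum_sum, hQ.sum_sum, sum_ite_eq'] at hsum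
    simp only [hx, if_true] at hsum
    have h9 := demand_le_add_two s t E τ r X
    have h10 : r ∈ X → _ := demand_le_of_mem s t E τ (r := r) (X := X)
    split_ifs at hsum with hrX
    · have := h10 hrX
      omega
    · omega

/-- Orientations of the edges between the classes of a partition and orientations of the classes
combine if the roots of the classes span the quotient. -/
theorem exists_parityOrientation_of_classes [DecidableEq α] {s t : β → α} {V : Finset α}
    {E : Finset β} {τ : α → ℕ} {r : α} (hE : ∀ e ∈ E, s e ∈ V ∧ t e ∈ V)
    {P : Finset (Finset α)} {c : α → Finset α} (hc : ∀ v ∈ V, c v ∈ P ∧ v ∈ c v)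
    (hc' : ∀ X ∈ P, ∀ v, v ∈ X → c v = X) {h₀ k₀ : β → α}
    (horient : ∀ e ∈ E, c (s e) ≠ c (t e) →
      (h₀ e = s e ∧ k₀ e = t e) ∨ (h₀ e = t e ∧ k₀ e = s e))
    {root : Finset α → α} {rank : Finset α → ℕ} (hroot : root (c r) = r)
    (hin : ∀ X ∈ P, X ≠ c r → ∃ e ∈ E, c (s e) ≠ c (t e) ∧ h₀ e = root X ∧
      rank (c (k₀ e)) < rank X)
    (hclass : ∀ X ∈ P, ∃ h k, IsParityOrientation s t X {e ∈ E | s e ∈ X ∧ t e ∈ X}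
      (fun v => τ v + #{e ∈ {e ∈ E | c (s e) ≠ c (t e)} | h₀ e = v}) (root X) h k) :
    ∃ h k, IsParityOrientation s t V E τ r h k := by
  have : Nonempty α := ⟨r⟩
  choose! h k hhk using hclass
  have hinside : ∀ e ∈ E, c (s e) = c (t e) →
      c (s e) ∈ P ∧ e ∈ {e' ∈ E | s e' ∈ c (s e) ∧ t e' ∈ c (s e)} := by
    intro e he heq
    refine ⟨(hc _ (hE e he).1).1, mem_filter.2 ⟨he, (hc _ (hE e he).1).2, ?_⟩⟩
    rw [heq]
    exact (hc _ (hE e he).2).2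
  refine ⟨fun e => if c (s e) = c (t e) then h (c (s e)) e else h₀ e,
    fun e => if c (s e) = c (t e) then k (c (s e)) e else k₀ e, ?_, ?_, ?_⟩
  · intro e he
    dsimp only
    split_ifs with heq
    · obtain ⟨hX, heX⟩ := hinside e he heq
      exact (hhk _ hX).1 e heX
    · exact horient e he heq
  · intro v hv
    rw [ncard_setOf_mem_and]
    obtain ⟨hvP, hvc⟩ := hc v hv
    have h1 := (hhk _ hvP).2.1 v hvc
    rw [ncard_setOf_mem_and] at h1
    dsimp only at h1
    have h2 : #{e ∈ E | (if c (s e) = c (t e) then h (c (s e)) e else h₀ e) = v} =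
        #{e ∈ {e ∈ E | c (s e) ≠ c (t e)} | h₀ e = v} +
        #{e ∈ {e ∈ E | s e ∈ c v ∧ t e ∈ c v} | h (c v) e = v} := by
      rw [← card_filter_add_card_filter_not (p := fun e => c (s e) ≠ c (t e)), filter_filter,
        filter_filter, filter_filter, filter_filter]
      congr 2
      · refine filter_congr fun e _ => ?_
        by_cases heq : c (s e) = c (t e) <;> simp [heq]
      · refine filter_congr fun e he => ?_
        constructor
        · rintro ⟨h3, h4⟩
          rw [not_not] at h4
          rw [if_pos h4] at h3
          obtain ⟨hX, heX⟩ := hinside e he h4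
          have hve : v ∈ c (s e) := by
            have h6 := mem_filter.1 heX
            rcases (hhk _ hX).1 e heX with h5 | h5
            · rw [← h3, h5.1]; exact h6.2.1
            · rw [← h3, h5.1]; exact h6.2.2
          rw [hc' _ hX v hve]
          exact ⟨(mem_filter.1 heX).2, h3⟩
        · rintro ⟨⟨h3, h4⟩, h5⟩
          rw [hc' _ hvP _ h3, hc' _ hvP _ h4]
          simpa using h5
    rw [h2]
    omega
  · intro Z hZ hne hrZ
    -- Take a vertex of `Z` whose class has least rank. If `Z` contains the root of that class, the
    -- edge entering there comes from a class of smaller rank, hence from outside `Z`. Otherwise the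
    -- orientation inside the class provides an edge entering `Z`.
    obtain ⟨v, hv, hmin⟩ := exists_min_image Z (fun v => rank (c v)) hne
    obtain ⟨hvP, hvc⟩ := hc v (hZ hv)
    by_cases hx : root (c v) ∈ Z
    · have hne : c v ≠ c r := by
        intro heq
        rw [heq, hroot] at hx
        exact hrZ hx
      obtain ⟨e, he, hcross, hhe, hrank⟩ := hin _ hvP hne
      refine ⟨e, he, ?_, ?_⟩
      · simp only [if_neg hcross, hhe, hx]
      · simp only [if_neg hcross]
        intro hk
        exact absurd (hmin _ hk) (not_le.2 hrank)
    · obtain ⟨e, he, h1, h2⟩ := (hhk _ hvP).2.2 (Z ∩ c v) inter_subset_right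
        ⟨v, mem_inter.2 ⟨hv, hvc⟩⟩ (fun h => hx (mem_inter.1 h).1)
      have h3 := (hhk _ hvP).1 e he
      obtain ⟨heE, hse, hte⟩ := mem_filter.1 he
      have h4 := hc' _ hvP _ hse
      have h5 := hc' _ hvP _ hte
      refine ⟨e, heE, ?_, ?_⟩
      · simp only [h4, h5, if_true]
        exact (mem_inter.1 h1).1
      · simp only [h4, h5, if_true]
        intro h6
        refine h2 (mem_inter.2 ⟨h6, ?_⟩)
        rcases h3 with h7 | h7 <;> rw [h7.2] <;> assumption

/-- The edges between the classes of a tight partition can be oriented so that each class is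
entered as often as it demands and all classes are reached from the class of the root. -/
theorem exists_orientation_of_tight [DecidableEq α] {s t : β → α} {V : Finset α} {E : Finset β}
    {τ : α → ℕ} {r : α} (hr : r ∈ V) (hE : ∀ e ∈ E, s e ∈ V ∧ t e ∈ V)
    (hcond : ∀ P, IsVertexPartition V P → ∑ X ∈ P, demand s t E τ r X ≤ #E)
    {P : Finset (Finset α)} (hP : IsVertexPartition V P)
    (htight : ∑ X ∈ P, demand s t E τ r X = #E) {c : α → Finset α}
    (hc : ∀ v ∈ V, c v ∈ P ∧ v ∈ c v) (hc' : ∀ X ∈ P, ∀ v, v ∈ X → c v = X) :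
    ∃ (h k : β → α) (root : Finset α → α) (rank : Finset α → ℕ),
      (∀ e ∈ E, c (s e) ≠ c (t e) → (h e = s e ∧ k e = t e) ∨ (h e = t e ∧ k e = s e)) ∧
      root (c r) = r ∧
      (∀ X ∈ P, root X ∈ X) ∧
      (∀ X ∈ P, X ≠ c r → ∃ e ∈ E, c (s e) ≠ c (t e) ∧ h e = root X ∧
        rank (c (k e)) < rank X) ∧
      ∀ X ∈ P, innerCard s t E X + ∑ v ∈ X, #{e ∈ {e ∈ E | c (s e) ≠ c (t e)} | h e = v} =
        demand s t E τ r X := by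
  classical
  set Ec : Finset β := {e ∈ E | c (s e) ≠ c (t e)} with hEc
  have hclassP : ∀ v ∈ V, c v ∈ P := fun v hv => (hc v hv).1
  have hEcP : ∀ e ∈ Ec, c (s e) ∈ P ∧ c (t e) ∈ P := fun e he =>
    ⟨hclassP _ (hE e (mem_filter.1 he).1).1, hclassP _ (hE e (mem_filter.1 he).1).2⟩
  have hVP : P.biUnion id = V := by
    ext v; simp [hP.2.2 v]
  have hle : ∀ X, innerCard s t E X ≤ demand s t E τ r X := fun X => innerCard_le_demand ..
  have hsub : ∀ Z : Finset (Finset α),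
      ∑ X ∈ Z, (demand s t E τ r X - innerCard s t E X) + ∑ X ∈ Z, innerCard s t E X =
        ∑ X ∈ Z, demand s t E τ r X := by
    intro Z
    rw [← sum_add_distrib]
    exact sum_congr rfl fun X _ => Nat.sub_add_cancel (hle X)
  have htotal : #Ec = ∑ X ∈ P, (demand s t E τ r X - innerCard s t E X) := by
    have h1 := innerCard_biUnion hc hc' hE (subset_refl P)
    rw [hVP, innerCard_self hE, filter_true_of_mem hEcP] at h1
    have h2 := hsub P
    omega
  -- Merging the classes in `Z` gives a partition with demand sum at most `|E|`, while that of `P`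
  -- equals `|E|`. This submodularity-like bound yields both Hakimi's condition and reachability.
  have hunion : ∀ Z ⊆ P, Z.Nonempty →
      demand s t E τ r (Z.biUnion id) ≤ ∑ X ∈ Z, demand s t E τ r X := by
    intro Z hZ hne
    obtain ⟨h1, h2⟩ := hP.merge hZ hne
    have h3 := hcond _ h1
    rw [sum_insert h2, ← htight, ← sum_sdiff hZ] at h3
    omega
  have hZ : ∀ Z ⊆ P, #{e ∈ Ec | c (s e) ∈ Z ∧ c (t e) ∈ Z} ≤
      ∑ X ∈ Z, (demand s t E τ r X - innerCard s t E X) := by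
    intro Z hZ
    rcases Z.eq_empty_or_nonempty with rfl | hne
    · simp
    · have h1 := innerCard_biUnion hc hc' hE hZ
      have h2 := hsub Z
      have h3 := hunion Z hZ hne
      have h4 := hle (Z.biUnion id)
      rw [← hEc] at h1
      omega
  obtain ⟨hd, hd1, hd2⟩ := exists_head_of_prescribed_indegree (fun e => c (s e))
    (fun e => c (t e)) Ec P _ hEcP htotal hZ
  set h : β → α := fun e => if hd e = c (s e) then s e else t e with hh
  set k : β → α := fun e => if hd e = c (s e) then t e else s e with hk
  have hhd : ∀ e ∈ Ec, c (h e) = hd e := by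
    intro e he
    simp only [hh]
    split_ifs with h1
    · exact h1.symm
    · exact ((hd1 e he).resolve_left h1).symm
  have hkV : ∀ e ∈ Ec, k e ∈ V := by
    intro e he
    have := hE e (mem_filter.1 he).1
    simp only [hk]
    split_ifs
    exacts [this.2, this.1]
  have hhV : ∀ e ∈ Ec, h e ∈ V := by
    intro e he
    have := hE e (mem_filter.1 he).1
    simp only [hh]
    split_ifs
    exacts [this.1, this.2]
  have hin : ∀ X ∈ P, innerCard s t E X + ∑ v ∈ X, #{e ∈ Ec | h e = v} =
      demand s t E τ r X := by
    intro X hX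
    have h1 : ∑ v ∈ X, #{e ∈ Ec | h e = v} = #{e ∈ Ec | hd e = X} := by
      rw [card_eq_sum_card_fiberwise (f := h) (t := X)]
      · refine sum_congr rfl fun v hv => ?_
        rw [filter_filter (fun e => hd e = X)]
        congr 1
        refine filter_congr fun e he => ⟨fun h2 => ⟨?_, h2⟩, fun h2 => h2.2⟩
        rw [← hhd e he, h2]
        exact hc' X hX v hv
      · intro e he
        obtain ⟨he1, he2⟩ := mem_filter.1 (mem_coe.1 he)
        rw [← hhd e he1] at he2
        rw [mem_coe, ← he2]
        exact (hc _ (hhV e he1)).2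
    have h2 := hle X
    rw [h1, hd2 X hX]
    omega
  -- If nothing entered `Z`, all edges counted by the demands of its classes would lie inside its
  -- union. That union would demand no more than its number of inner edges, impossible as it avoids
  -- `r`.
  have hcut : ∀ Z ⊆ P, Z.Nonempty → c r ∉ Z → ∃ e ∈ Ec, hd e ∈ Z ∧ c (k e) ∉ Z := by
    intro Z hZP hne hrZ
    by_contra hcon
    push Not at hcon
    have h1 : #{e ∈ Ec | hd e ∈ Z} = ∑ X ∈ Z, (demand s t E τ r X - innerCard s t E X) := by
      rw [card_eq_sum_card_fiberwise (f := hd) (t := Z)]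
      · refine sum_congr rfl fun X hX => ?_
        rw [filter_filter, ← hd2 X (hZP hX)]
        congr 1
        refine filter_congr fun e he => ⟨fun h2 => h2.2, fun h2 => ⟨h2 ▸ hX, h2⟩⟩
      · intro e he
        exact (mem_filter.1 (mem_coe.1 he)).2
    have h2 : #{e ∈ Ec | hd e ∈ Z} ≤ #{e ∈ Ec | c (s e) ∈ Z ∧ c (t e) ∈ Z} := by
      refine card_le_card fun e he => ?_
      obtain ⟨he1, he2⟩ := mem_filter.1 he
      have h3 := hcon e he1 he2
      rw [← hhd e he1] at he2
      refine mem_filter.2 ⟨he1, ?_⟩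
      simp only [hh, hk] at he2 h3
      split_ifs at he2 h3
      exacts [⟨he2, h3⟩, ⟨h3, he2⟩]
    have h3 := innerCard_biUnion hc hc' hE hZP
    have h4 := hsub Z
    have h5 := hunion Z hZP hne
    have h6 : r ∉ Z.biUnion id := by
      intro h
      obtain ⟨X, hX, hrX⟩ := mem_biUnion.1 h
      exact hrZ (hc' X (hZP hX) r hrX ▸ hX)
    have h7 := innerCard_lt_demand s t E τ h6
    rw [← hEc] at h3
    omega
  have harb : ∃ (rank : Finset α → ℕ) (root : Finset α → α), root (c r) = r ∧
      ∀ X ∈ P, X ≠ c r → ∃ e ∈ Ec, hd e = X ∧ h e = root X ∧ rank (c (k e)) < rank X := by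
    rcases isEmpty_or_nonempty β with hβ | hβ
    · refine ⟨fun _ => 0, fun _ => r, rfl, fun X hX hne => ?_⟩
      obtain ⟨e, -⟩ := hcut {X} (by simpa using hX) (by simp) (by simpa using Ne.symm hne)
      exact (hβ.false e).elim
    · obtain ⟨rank, f, hf⟩ := exists_arborescence hd (fun e => c (k e)) Ec P (hclassP r hr)
        (fun e he => hclassP _ (hkV e he)) hcut
      -- The root of a class is the vertex at which its arborescence edge enters.
      refine ⟨rank, fun X => if X = c r then r else h (f X), by simp, fun X hX hne => ?_⟩
      obtain ⟨h1, h2, h3⟩ := hf X hX hne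
      exact ⟨f X, h1, h2, by simp [hne], h3⟩
  obtain ⟨rank, root, hroot, harb⟩ := harb
  refine ⟨h, k, root, rank, ?_, hroot, ?_, ?_, hin⟩
  · intro e _ _
    simp only [hh, hk]
    split_ifs <;> simp
  · intro X hX
    by_cases hXr : X = c r
    · rw [hXr, hroot]
      exact (hc r hr).2
    · obtain ⟨e, he, h1, h2, -⟩ := harb X hX hXr
      rw [← h2, ← h1, ← hhd e he]
      exact (hc _ (hhV e he)).2
  · intro X hX hXr
    obtain ⟨e, he, -, h2, h3⟩ := harb X hX hXr
    exact ⟨e, (mem_filter.1 he).1, (mem_filter.1 he).2, h2, h3⟩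

/-- The orientation theorem with parity conditions of Frank, Jordán and Szigeti for
root-connected orientations. -/
theorem exists_parityOrientation (s t : β → α) (n : ℕ) :
    ∀ (V : Finset α) (E : Finset β) (τ : α → ℕ) (r : α), #V + #E = n → r ∈ V →
      (∀ e ∈ E, s e ∈ V ∧ t e ∈ V) → #E % 2 = (∑ v ∈ V, τ v) % 2 →
      (∀ P, IsVertexPartition V P → ∑ X ∈ P, demand s t E τ r X ≤ #E) →
      ∃ h k, IsParityOrientation s t V E τ r h k := by
  classical
  induction n using Nat.strong_induction_on with
  | _ n ih =>
  intro V E τ r hn hr hE hpar hcond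
  -- Induction on `|V| + |E|`. A tight partition with at least two classes reduces the problem to
  -- its classes; if there is none, parity leaves room to delete an edge.
  let tight : Finset (Finset α) → Prop := fun P =>
    IsVertexPartition V P ∧ ∑ X ∈ P, demand s t E τ r X = #E
  by_cases hex : ∃ P, tight P ∧ 2 ≤ #P
  · have hbound : ∀ P, tight P → #P ≤ #V.powerset := fun P hP =>
      card_le_card fun X hX => mem_powerset.2 (hP.1.subset hX)
    obtain ⟨P, ⟨⟨hP, htight⟩, hP2⟩, hmax⟩ :
        ∃ P, (tight P ∧ 2 ≤ #P) ∧ ∀ P', tight P' → #P' ≤ #P := by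
      have hne : ∃ m, ∃ P, (tight P ∧ 2 ≤ #P) ∧ #V.powerset - #P = m := by
        obtain ⟨P, hP⟩ := hex
        exact ⟨_, P, hP, rfl⟩
      obtain ⟨P, hP, hPm⟩ := Nat.find_spec hne
      refine ⟨P, hP, fun P' hP' => ?_⟩
      by_contra hlt
      have h1 := Nat.find_min' hne ⟨P', ⟨hP', by omega⟩, rfl⟩
      have h2 := hbound P' hP'
      omega
    obtain ⟨c, hc, hc'⟩ := hP.exists_class
    obtain ⟨h₀, k₀, root, rank, horient, hroot, hrootmem, hin, hdeg⟩ :=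
      exists_orientation_of_tight hr hE hcond hP htight hc hc'
    refine exists_parityOrientation_of_classes hE hc hc' horient hroot hin fun X hX => ?_
    have hinner : #{e ∈ E | s e ∈ X ∧ t e ∈ X} = innerCard s t E X := (innerCard_eq ..).symm
    have hXV : X ⊂ V := by
      refine (hP.subset hX).ssubset_of_ne fun heq => ?_
      obtain ⟨Y, hY, hne⟩ := exists_mem_ne hP2 X
      obtain ⟨v, hv⟩ := hP.1 Y hY
      exact hne (hP.2.1 Y hY X hX v hv (heq ▸ hP.subset hY hv))
    have hdegX := hdeg X hX
    refine ih _ ?_ X _ _ (root X) rfl (hrootmem X hX) (fun e he => (mem_filter.1 he).2) ?_ ?_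
    · have h1 := card_lt_card hXV
      have h2 := card_filter_le E fun e => s e ∈ X ∧ t e ∈ X
      omega
    · have h1 := demand_mod s t E τ r X
      rw [sum_add_distrib, hinner]
      omega
    · intro Q hQ
      rw [hinner]
      refine sum_demand_class_le hQ (hrootmem X hX) ?_ ?_ hdegX ?_
      · intro hrX
        rw [← hc' X hX r hrX, hroot]
      · intro hrX
        obtain ⟨e, he, hcross, hhe, -⟩ := hin X hX (fun h => hrX (h ▸ (hc r hr).2))
        exact card_pos.2 ⟨e, mem_filter.2 ⟨mem_filter.2 ⟨he, hcross⟩, hhe⟩⟩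
      · intro hQ2
        obtain ⟨hP', hdisj⟩ := hP.refine_class hX hQ
        have h1 := hcond _ hP'
        have h2 := sum_demand_mod hP' s t E τ r
        -- The refined partition has more classes than the maximal `P`, so it is not tight. Its
        -- demand sum has the parity of `|E|`, so the slack is at least 2.
        have h3 : ∑ Y ∈ P.erase X ∪ Q, demand s t E τ r Y ≠ #E := by
          intro heq
          have := hmax _ ⟨hP', heq⟩
          rw [card_union_of_disjoint hdisj, card_erase_of_mem hX] at this
          omega
        rw [sum_union hdisj] at h1 h2 h3
        have h4 := add_sum_erase P (fun Y => demand s t E τ r Y) hX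
        omega
  · rcases E.eq_empty_or_nonempty with rfl | ⟨e₀, he₀⟩
    -- Without edges, the partition into singletons leaves no room for a vertex other than `r`,
    -- which would demand at least one edge.
    · have hV : V = {r} := by
        by_contra hne
        obtain ⟨v, hv, hvr⟩ : ∃ v ∈ V, v ≠ r := by
          by_contra! hall
          exact hne (eq_singleton_iff_unique_mem.2 ⟨hr, hall⟩)
        have h1 := hcond _ (IsVertexPartition.image_singleton V)
        have h2 := single_le_sum (f := fun X => demand s t ∅ τ r X) (fun _ _ => Nat.zero_le _)
          (mem_image_of_mem (fun v => ({v} : Finset α)) hv)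
        have h3 := innerCard_lt_demand s t ∅ τ (r := r) (X := {v}) (by simpa using Ne.symm hvr)
        simp only [card_empty] at h1 h2
        omega
      refine ⟨s, t, by simp, ?_, ?_⟩
      · intro v hv
        rw [hV, mem_singleton] at hv
        subst hv
        rw [ncard_setOf_mem_and]
        simpa [hV] using hpar
      · intro Z hZ hne hrZ
        obtain ⟨v, hv⟩ := hne
        have := hZ hv
        rw [hV, mem_singleton] at this
        exact absurd (this ▸ hv) hrZ
    · refine exists_parityOrientation_of_erase he₀ (ih _ ?_ V (E.erase e₀) _ r rfl hr
        (fun e he => hE e (mem_of_mem_erase he)) ?_ ?_)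
      · have := card_erase_lt_of_mem he₀
        omega
      · rw [card_erase_of_mem he₀, sum_add_distrib, sum_ite_eq', if_pos (hE e₀ he₀).2]
        have := card_pos.2 ⟨e₀, he₀⟩
        omega
      · intro P hP
        have hcard := card_pos.2 ⟨e₀, he₀⟩
        rw [card_erase_of_mem he₀]
        -- With several classes, parity gives slack 2, which pays for the lost edge and for the
        -- increase of the demands by at most 1. The one-class partition is tight and is checked
        -- directly.
        by_cases hP1 : #P ≤ 1
        · rw [hP.eq_singleton ⟨r, hr⟩ hP1, sum_singleton]
          refine demand_le ?_ (fun h => absurd hr h) ?_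
          · rw [innerCard_self fun e he => hE e (mem_of_mem_erase he), card_erase_of_mem he₀]
          · rw [sum_add_distrib, sum_ite_eq', if_pos (hE e₀ he₀).2]
            omega
        · have h1 := sum_demand_erase_le (s := s) (E := E) (τ := τ) (r := r) (hE e₀ he₀).2 hP
          have h2 := hcond P hP
          have h3 := sum_demand_mod hP s t E τ r
          have h4 : ∑ X ∈ P, demand s t E τ r X ≠ #E := fun h => hex ⟨P, ⟨hP, h⟩, by omega⟩
          omega

end Orientation

end Graph

namespace Graph

universe u v

variable {α : Type u} {β : Type v} {G H : Graph α β}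

/-! ### Degree counting in multigraphs -/

section Counting

open Finset

theorem IsFinite.mono (hG : G.IsFinite) (h : H ≤ G) : H.IsFinite :=
  ⟨hG.1.subset h.vertexSet_mono, hG.2.subset h.edgeSet_mono⟩

theorem HasCycle.mono (hH : H.HasCycle) (h : H ≤ G) : G.HasCycle := by
  obtain ⟨C, hC, hC'⟩ := hH
  exact ⟨C, hC.trans h, hC'⟩

theorem deleteEdges_isLink_iff {B : Set β} {e : β} {x y : α} :
    (G.deleteEdges B).IsLink e x y ↔ G.IsLink e x y ∧ e ∉ B :=
  Iff.of_eq (deleteEdges_isLink ..)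

theorem edgeCut_subset_edgeSet (G : Graph α β) (X : Set α) : G.edgeCut X ⊆ G.edgeSet := by
  rintro e ⟨x, y, h, -, -⟩
  exact h.edge_mem

theorem edgeSet_induce_subset (G : Graph α β) (X : Set α) : (G.induce X).edgeSet ⊆ G.edgeSet := by
  rintro e ⟨x, y, h, -, -⟩
  exact h.edge_mem

theorem edgeCut_vertexSet (G : Graph α β) : G.edgeCut G.vertexSet = ∅ := by
  ext e
  simp only [edgeCut, Set.mem_ofPred_eq, Set.mem_empty_iff_false, iff_false]
  rintro ⟨x, y, h, -, hy⟩
  exact hy h.right_mem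

theorem edgeCut_diff (G : Graph α β) (X : Set α) :
    G.edgeCut (G.vertexSet \ X) = G.edgeCut X := by
  ext e
  constructor
  · rintro ⟨x, y, h, hx, hy⟩
    exact ⟨y, x, h.symm, by_contra fun h' => hy ⟨h.right_mem, h'⟩, hx.2⟩
  · rintro ⟨x, y, h, hx, hy⟩
    exact ⟨y, x, h.symm, ⟨h.right_mem, hy⟩, fun h' => h'.2 hx⟩

/-- Ends of the edges of a graph. -/
theorem exists_ends [Nonempty α] (G : Graph α β) :
    ∃ s t : β → α, ∀ e ∈ G.edgeSet, G.IsLink e (s e) (t e) := by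
  have h : ∀ e ∈ G.edgeSet, ∃ x y, G.IsLink e x y := fun e he => exists_isLink_of_mem_edgeSet he
  choose! s t hst using h
  exact ⟨s, t, hst⟩

theorem valency_eq_card [DecidableEq α] {s t : β → α}
    (hst : ∀ e ∈ G.edgeSet, G.IsLink e (s e) (t e)) {E : Finset β} (hE : (E : Set β) = G.edgeSet)
    (v : α) : G.valency v = ((#{e ∈ E | s e = v} + #{e ∈ E | t e = v} : ℕ) : ℕ∞) := by
  classical
  have hmem : ∀ e, e ∈ E ↔ e ∈ G.edgeSet := fun e => by rw [← hE]; rfl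
  have h1 : G.incidenceSet v = (({e ∈ E | s e = v} ∪ {e ∈ E | t e = v} : Finset β) : Set β) := by
    ext e
    simp only [mem_incidenceSet, coe_union, coe_filter, Set.mem_union, Set.mem_ofPred_eq, hmem]
    constructor
    · intro h
      have he := h.edge_mem
      rcases h.eq_or_eq_of_isLink (hst e he) with h' | h'
      exacts [Or.inl ⟨he, h'.symm⟩, Or.inr ⟨he, h'.symm⟩]
    · rintro (⟨he, rfl⟩ | ⟨he, rfl⟩)
      exacts [(hst e he).inc_left, (hst e he).inc_right]
  have h2 : G.loopSet v = (({e ∈ E | s e = v} ∩ {e ∈ E | t e = v} : Finset β) : Set β) := by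
    ext e
    simp only [mem_loopSet, coe_inter, coe_filter, Set.mem_inter_iff, Set.mem_ofPred_eq, hmem]
    constructor
    · intro h
      have he := h.edge_mem
      exact ⟨⟨he, (h.eq_of_inc (hst e he).inc_left).symm⟩,
        ⟨he, (h.eq_of_inc (hst e he).inc_right).symm⟩⟩
    · rintro ⟨⟨he, h1⟩, -, h2⟩
      have := hst e he
      rwa [h1, h2] at this
  rw [valency, h1, h2, Set.encard_coe_eq_coe_finsetCard, Set.encard_coe_eq_coe_finsetCard,
    ← Nat.cast_add, card_union_add_card_inter]

/-- The handshaking lemma for a set of vertices. -/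
theorem sum_valency [Nonempty α] (hG : G.IsFinite) (X : Finset α) :
    ∑ v ∈ X, G.valency v =
      ((2 * (G.induce X).edgeSet.ncard + (G.edgeCut X).ncard : ℕ) : ℕ∞) := by
  classical
  obtain ⟨s, t, hst⟩ := exists_ends G
  set E : Finset β := hG.2.toFinset with hEdef
  have hE : (E : Set β) = G.edgeSet := by simp [hEdef]
  have hmem : ∀ e, e ∈ E ↔ e ∈ G.edgeSet := fun e => by simp [hEdef]
  have h1 : (G.induce X).edgeSet = (({e ∈ E | s e ∈ X ∧ t e ∈ X} : Finset β) : Set β) := by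
    ext e
    simp only [edgeSet_induce, coe_filter, Set.mem_ofPred_eq, mem_coe, hmem]
    constructor
    · rintro ⟨x, y, h, hx, hy⟩
      refine ⟨h.edge_mem, ?_⟩
      rcases (hst e h.edge_mem).eq_and_eq_or_eq_and_eq h with ⟨h1, h2⟩ | ⟨h1, h2⟩ <;>
        rw [h1, h2] <;> exact ⟨by assumption, by assumption⟩
    · rintro ⟨he, h⟩
      exact ⟨_, _, hst e he, h⟩
  have h2 : G.edgeCut X = (({e ∈ E | (s e ∈ X ∧ t e ∉ X) ∨ (s e ∉ X ∧ t e ∈ X)} : Finset β) :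
      Set β) := by
    ext e
    simp only [edgeCut, coe_filter, Set.mem_ofPred_eq, mem_coe, hmem]
    constructor
    · rintro ⟨x, y, h, hx, hy⟩
      refine ⟨h.edge_mem, ?_⟩
      rcases (hst e h.edge_mem).eq_and_eq_or_eq_and_eq h with ⟨h1, h2⟩ | ⟨h1, h2⟩ <;>
        rw [h1, h2]
      exacts [Or.inl ⟨hx, hy⟩, Or.inr ⟨hy, hx⟩]
    · rintro ⟨he, h | h⟩
      exacts [⟨_, _, hst e he, h⟩, ⟨_, _, (hst e he).symm, h.symm⟩]
  have h3 : ∀ f : β → α, ∑ v ∈ X, #{e ∈ E | f e = v} = #{e ∈ E | f e ∈ X} := by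
    intro f
    rw [card_eq_sum_card_fiberwise (s := {e ∈ E | f e ∈ X}) (f := f) (t := X)]
    · refine sum_congr rfl fun v hv => ?_
      rw [filter_filter]
      congr 1
      refine filter_congr fun e _ => ⟨fun h => ⟨h ▸ hv, h⟩, fun h => h.2⟩
    · intro e he
      exact (mem_filter.1 (mem_coe.1 he)).2
  rw [h1, h2, Set.ncard_coe_finset, Set.ncard_coe_finset,
    sum_congr rfl fun v _ => valency_eq_card hst hE v, ← Nat.cast_sum, sum_add_distrib, h3, h3]
  congr 1
  have h4 := card_filter_add_card_filter_not (s := {e ∈ E | s e ∈ X}) (p := fun e => t e ∈ X)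
  have h5 := card_filter_add_card_filter_not (s := {e ∈ E | t e ∈ X}) (p := fun e => s e ∈ X)
  rw [filter_filter, filter_filter] at h4 h5
  rw [filter_or, card_union_of_disjoint]
  · have h6 : {e ∈ E | t e ∈ X ∧ s e ∈ X} = {e ∈ E | s e ∈ X ∧ t e ∈ X} :=
      filter_congr fun e _ => and_comm
    have h7 : {e ∈ E | t e ∈ X ∧ s e ∉ X} = {e ∈ E | s e ∉ X ∧ t e ∈ X} :=
      filter_congr fun e _ => and_comm
    rw [h6, h7] at h5
    omega
  · rw [disjoint_filter]
    tauto

theorem two_mul_ncard_edgeSet_induce_of_valency_eq [Nonempty α] (hG : G.IsFinite) {k : ℕ}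
    {X : Set α} (hX : X.Finite) (h : ∀ v ∈ X, G.valency v = k) :
    2 * (G.induce X).edgeSet.ncard + (G.edgeCut X).ncard = k * X.ncard := by
  have h1 := sum_valency hG hX.toFinset
  rw [sum_congr rfl fun v hv => h v (hX.mem_toFinset.1 hv), sum_const,
    ← Set.ncard_eq_toFinset_card X hX, hX.coe_toFinset, nsmul_eq_mul, ← Nat.cast_mul,
    Nat.cast_inj] at h1
  rw [← h1, mul_comm]

theorem IsCubic.two_mul_ncard_add (hcubic : G.IsCubic) (hG : G.IsFinite) {X : Set α}
    (hX : X ⊆ G.vertexSet) :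
    2 * (G.induce X).edgeSet.ncard + (G.edgeCut X).ncard = 3 * X.ncard := by
  rcases X.eq_empty_or_nonempty with rfl | ⟨x, hx⟩
  · simp [edgeSet_induce, edgeCut]
  · have : Nonempty α := ⟨x⟩
    exact two_mul_ncard_edgeSet_induce_of_valency_eq hG (hG.1.subset hX) fun v hv =>
      hcubic v (hX hv)

theorem IsCycle.ncard_edgeSet {C : Graph α β} (hC : C.IsCycle) :
    C.edgeSet.ncard = C.vertexSet.ncard := by
  obtain ⟨x, hx⟩ := hC.2.1.1
  have : Nonempty α := ⟨x⟩
  have h := two_mul_ncard_edgeSet_induce_of_valency_eq (k := 2) hC.1 hC.1.1 hC.2.2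
  rw [edgeCut_vertexSet, induce_vertexSet, Set.ncard_empty] at h
  omega

end Counting

/-! ### Reachability, existence of cycles, cycle-separating cuts -/

section Connectivity

theorem Reaches.symm {x y : α} (h : G.Reaches x y) : G.Reaches y x := by
  induction h with
  | refl => exact .refl
  | tail _ h ih => exact Relation.ReflTransGen.head h.symm ih

theorem Reaches.mono {x y : α} (h : G.Reaches x y) (hle : G ≤ H) : H.Reaches x y := by
  induction h with
  | refl => exact .refl
  | tail _ h ih => exact Relation.ReflTransGen.tail ih (h.mono hle)

/-- A set of vertices that no edge leaves contains everything reachable from it. -/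
theorem Reaches.mem_of_closed {x y : α} (h : G.Reaches x y) {X : Set α}
    (hX : ∀ u v, G.Adj u v → u ∈ X → v ∈ X) (hx : x ∈ X) : y ∈ X := by
  induction h with
  | refl => exact hx
  | tail _ h ih => exact hX _ _ h ih

theorem exists_closed_of_not_isConnected (hne : G.vertexSet.Nonempty) (h : ¬ G.IsConnected) :
    ∃ Y ⊆ G.vertexSet, Y.Nonempty ∧ (G.vertexSet \ Y).Nonempty ∧
      ∀ u v, G.Adj u v → u ∈ Y → v ∈ Y := by
  simp only [IsConnected, hne, true_and] at h
  push Not at h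
  obtain ⟨x, hx, y, hy, hxy⟩ := h
  refine ⟨{z | z ∈ G.vertexSet ∧ G.Reaches x z}, fun z hz => hz.1, ⟨x, hx, .refl⟩,
    ⟨y, hy, fun h => hxy h.2⟩, fun u v huv hu => ⟨huv.right_mem, hu.2.tail huv⟩⟩

theorem isConnected_of_forall_exists_adj {r : α} (hr : r ∈ G.vertexSet)
    (h : ∀ Z ⊆ G.vertexSet, Z.Nonempty → r ∉ Z → ∃ u v, G.Adj u v ∧ u ∈ Z ∧ v ∉ Z) :
    G.IsConnected := by
  by_contra hcon
  obtain ⟨Y, hY, hne, hne', hcl⟩ := exists_closed_of_not_isConnected ⟨r, hr⟩ hcon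
  by_cases hrY : r ∈ Y
  · obtain ⟨u, v, huv, hu, hv⟩ := h (G.vertexSet \ Y) Set.sdiff_subset hne' (fun h => h.2 hrY)
    have hvY : v ∈ Y := by_contra fun h' => hv ⟨huv.right_mem, h'⟩
    exact hu.2 (hcl v u huv.symm hvY)
  · obtain ⟨u, v, huv, hu, hv⟩ := h Y hY hne hrY
    exact hv (hcl u v huv hu)

/-- A finite graph with at least as many edges as vertices contains a cycle. -/
theorem hasCycle_of_ncard_le (n : ℕ) : ∀ G : Graph α β, G.IsFinite → G.vertexSet.Nonempty →
    G.vertexSet.ncard ≤ G.edgeSet.ncard → G.vertexSet.ncard + G.edgeSet.ncard = n →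
    G.HasCycle := by
  classical
  induction n using Nat.strong_induction_on with
  | _ n ih =>
  intro G hG hne hle hn
  have : Nonempty α := ⟨hne.some⟩
  have hsum := sum_valency hG hG.1.toFinset
  rw [hG.1.coe_toFinset, edgeCut_vertexSet, induce_vertexSet, Set.ncard_empty, add_zero] at hsum
  -- Deleting a vertex of valency at most 1, or an edge when edges outnumber vertices, preserves the
  -- inequality. Otherwise handshaking forces every valency to be 2, and the graph is a cycle or has
  -- a smaller union of components to which induction applies.
  by_cases hlow : ∃ v ∈ G.vertexSet, G.valency v ≤ 1
  · obtain ⟨v, hv, hval⟩ := hlow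
    have hdel : (G.deleteVerts {v}).edgeSet = G.edgeSet \ G.incidenceSet v := by
      ext e
      simp only [edgeSet_deleteVerts, Set.mem_singleton_iff, Set.mem_ofPred_eq, Set.mem_sdiff,
        mem_incidenceSet]
      constructor
      · rintro ⟨x, y, h, hx, hy⟩
        refine ⟨h.edge_mem, fun h' => ?_⟩
        rcases h'.eq_or_eq_of_isLink h with rfl | rfl <;> contradiction
      · rintro ⟨he, h⟩
        obtain ⟨x, y, hxy⟩ := exists_isLink_of_mem_edgeSet he
        exact ⟨x, y, hxy, fun hx => h (hx ▸ hxy.inc_left), fun hy => h (hy ▸ hxy.inc_right)⟩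
    have hinc : (G.incidenceSet v).ncard ≤ 1 := by
      have h1 : (G.incidenceSet v).encard ≤ 1 := le_self_add.trans hval
      have h2 : (G.incidenceSet v).Finite := hG.2.subset (G.incidenceSet_subset_edgeSet v)
      rw [← h2.cast_ncard_eq] at h1
      exact_mod_cast h1
    have hV : (G.deleteVerts {v}).vertexSet.ncard + 1 = G.vertexSet.ncard := by
      rw [vertexSet_deleteVerts, Set.ncard_sdiff_singleton_add_one hv hG.1]
    have hE : G.edgeSet.ncard ≤ (G.deleteVerts {v}).edgeSet.ncard + 1 := by
      rw [hdel]
      have := Set.ncard_le_ncard_sdiff_add_ncard G.edgeSet (G.incidenceSet v)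
        (hG.2.subset (G.incidenceSet_subset_edgeSet v))
      omega
    have hE' : (G.deleteVerts {v}).edgeSet.ncard ≤ G.edgeSet.ncard :=
      Set.ncard_le_ncard deleteVerts_le.edgeSet_mono hG.2
    have hne' : (G.deleteVerts {v}).vertexSet.Nonempty := by
      by_contra hemp
      rw [Set.not_nonempty_iff_eq_empty, vertexSet_deleteVerts, Set.sdiff_eq_empty] at hemp
      have hVv : G.vertexSet = {v} := hemp.antisymm (by simpa using hv)
      have h1 : hG.1.toFinset = {v} := by ext; simp [hVv]
      rw [h1, Finset.sum_singleton] at hsum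
      rw [hsum] at hval
      have h2 : 2 * G.edgeSet.ncard ≤ 1 := by exact_mod_cast hval
      have h3 : G.vertexSet.ncard = 1 := by rw [hVv, Set.ncard_singleton]
      omega
    exact (ih _ (by omega) (G.deleteVerts {v}) (hG.mono deleteVerts_le) hne' (by omega) rfl).mono
      deleteVerts_le
  by_cases hlt : G.vertexSet.ncard < G.edgeSet.ncard
  · obtain ⟨e, he⟩ : G.edgeSet.Nonempty := Set.nonempty_of_ncard_ne_zero (by omega)
    have h1 : (G.deleteEdges {e}).edgeSet.ncard + 1 = G.edgeSet.ncard := by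
      rw [edgeSet_deleteEdges, Set.ncard_sdiff_singleton_add_one he hG.2]
    have h2 : (G.deleteEdges {e}).vertexSet = G.vertexSet := vertexSet_deleteEdges ..
    exact (ih _ (by rw [h2]; omega) (G.deleteEdges {e}) (hG.mono deleteEdges_le) (h2 ▸ hne)
      (by rw [h2]; omega) rfl).mono deleteEdges_le
  have hval : ∀ v ∈ G.vertexSet, G.valency v = 2 := by
    have h1 : ∀ v ∈ hG.1.toFinset, (2 : ℕ∞) ≤ G.valency v := by
      intro v hv
      push Not at hlow
      have := hlow v (hG.1.mem_toFinset.1 hv)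
      have := Order.add_one_le_of_lt this
      rwa [one_add_one_eq_two] at this
    obtain ⟨s, t, hst⟩ := exists_ends G
    have h2 := fun v => valency_eq_card hst (E := hG.2.toFinset) (by simp) v
    simp only [h2] at h1 hsum ⊢
    have h4 : ∀ v ∈ hG.1.toFinset, 2 ≤ ((hG.2.toFinset.filter fun e => s e = v).card +
        (hG.2.toFinset.filter fun e => t e = v).card) := by
      intro v hv
      exact_mod_cast h1 v hv
    have h3 : ∑ v ∈ hG.1.toFinset, 2 = ∑ v ∈ hG.1.toFinset,
        ((hG.2.toFinset.filter fun e => s e = v).card +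
        (hG.2.toFinset.filter fun e => t e = v).card) := by
      rw [← Nat.cast_sum, Nat.cast_inj] at hsum
      rw [hsum, Finset.sum_const, smul_eq_mul, ← Set.ncard_eq_toFinset_card _ hG.1]
      omega
    intro v hv
    have := (Finset.sum_eq_sum_iff_of_le h4).1 h3 v (hG.1.mem_toFinset.2 hv)
    rw [← this]
    rfl
  by_cases hconn : G.IsConnected
  · exact ⟨G, le_refl G, hG, hconn, hval⟩
  · obtain ⟨Y, hY, hYne, hYne', hcl⟩ := exists_closed_of_not_isConnected hne hconn
    have hcut : G.edgeCut Y = ∅ := by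
      ext e
      simp only [edgeCut, Set.mem_ofPred_eq, Set.mem_empty_iff_false, iff_false]
      rintro ⟨x, y, h, hx, hy⟩
      exact hy (hcl x y h.adj hx)
    have h1 := two_mul_ncard_edgeSet_induce_of_valency_eq (k := 2) hG (hG.1.subset hY)
      fun v hv => hval v (hY hv)
    rw [hcut, Set.ncard_empty] at h1
    have h2 : Y.ncard < G.vertexSet.ncard :=
      Set.ncard_lt_ncard (hY.ssubset_of_not_subset fun h => hYne'.some_mem.2
        (h hYne'.some_mem.1)) hG.1
    have h3 : (G.induce Y).vertexSet = Y := rfl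
    have hle' := induce_le hY
    have h4 : (G.induce Y).edgeSet.ncard ≤ G.edgeSet.ncard :=
      Set.ncard_le_ncard hle'.edgeSet_mono hG.2
    exact (ih _ (by rw [h3]; omega) (G.induce Y) (hG.mono hle') hYne (by rw [h3]; omega)
      rfl).mono hle'

theorem IsForest.ncard_lt (hG : G.IsForest) (hfin : G.IsFinite) (hne : G.vertexSet.Nonempty) :
    G.edgeSet.ncard < G.vertexSet.ncard := by
  by_contra h
  exact hG (hasCycle_of_ncard_le _ G hfin hne (not_lt.1 h) rfl)

theorem IsCycle.le_induce_component {C : Graph α β} (hC : C.IsCycle) (hle : C ≤ G) {x : α}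
    (hx : x ∈ C.vertexSet) : C ≤ G.induce {y | G.Reaches x y} := by
  have h1 : C.vertexSet ⊆ {y | G.Reaches x y} := fun y hy => (hC.2.1.2 x hx y hy).mono hle
  exact ⟨h1, fun e u v h => ⟨hle.isLink_mono h, h1 h.left_mem, h1 h.right_mem⟩⟩

theorem isCycleSeparating_edgeCut {X : Set α} (h1 : (G.induce X).HasCycle)
    (hX : X ⊆ G.vertexSet) (h2 : (G.induce (G.vertexSet \ X)).HasCycle) :
    G.IsCycleSeparating (G.edgeCut X) := by
  have hclosed : ∀ u v, (G.deleteEdges (G.edgeCut X)).Adj u v → (u ∈ X ↔ v ∈ X) := by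
    rintro u v ⟨e, he⟩
    obtain ⟨he, hcut⟩ := deleteEdges_isLink_iff.1 he
    constructor
    · intro hu
      by_contra hv
      exact hcut ⟨u, v, he, hu, hv⟩
    · intro hv
      by_contra hu
      exact hcut ⟨v, u, he.symm, hv, hu⟩
  have hle : ∀ Y ⊆ G.vertexSet, (∀ u v, u ∈ Y → v ∈ Y → (u ∈ X ↔ v ∈ X)) →
      G.induce Y ≤ G.deleteEdges (G.edgeCut X) := by
    intro Y hY hYX
    refine ⟨hY, fun e u v h => ?_⟩
    obtain ⟨h, hu, hv⟩ := h
    refine deleteEdges_isLink_iff.2 ⟨h, ?_⟩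
    rintro ⟨a, b, hab, ha, hb⟩
    have := hYX u v hu hv
    rcases h.eq_and_eq_or_eq_and_eq hab with ⟨rfl, rfl⟩ | ⟨rfl, rfl⟩ <;> tauto
  obtain ⟨C, hC, hCcyc⟩ := h1
  obtain ⟨D, hD, hDcyc⟩ := h2
  obtain ⟨x, hx⟩ := hCcyc.2.1.1
  obtain ⟨y, hy⟩ := hDcyc.2.1.1
  have hxX : x ∈ X := hC.vertexSet_mono hx
  have hyX : y ∈ G.vertexSet \ X := hD.vertexSet_mono hy
  refine ⟨edgeCut_subset_edgeSet G X, _, _, ?_, ⟨x, hX hxX, rfl⟩, ⟨y, hyX.1, rfl⟩, ?_, ?_⟩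
  · intro heq
    have h1 : y ∈ {z | (G.deleteEdges (G.edgeCut X)).Reaches x z} := by
      rw [heq]
      exact Relation.ReflTransGen.refl
    exact hyX.2 (Reaches.mem_of_closed h1 (fun u v huv => (hclosed u v huv).1) hxX)
  · exact ⟨C, hCcyc.le_induce_component
      (hC.trans (hle X hX fun u v hu hv => by simp [hu, hv])) hx, hCcyc⟩
  · exact ⟨D, hDcyc.le_induce_component
      (hD.trans (hle _ Set.sdiff_subset fun u v hu hv => by simp [hu.2, hv.2])) hy, hDcyc⟩

/-- One of the two cyclic components of `G - B` serves as `X`: every edge leaving it belongs to `B`.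
Cycle-separating sets may thus be replaced by edge cuts. -/
theorem IsCycleSeparating.exists_edgeCut_subset {B : Set β} (h : G.IsCycleSeparating B) :
    ∃ X ⊆ G.vertexSet, (G.induce X).HasCycle ∧ (G.induce (G.vertexSet \ X)).HasCycle ∧
      G.edgeCut X ⊆ B := by
  obtain ⟨-, C, D, hne, ⟨x, hx, rfl⟩, ⟨y, hy, rfl⟩, hC, hD⟩ := h
  have hsub : ∀ z ∈ G.vertexSet,
      {w | (G.deleteEdges B).Reaches z w} ⊆ G.vertexSet := by
    intro z hz w hw
    exact Reaches.mem_of_closed hw (fun u v huv _ => huv.right_mem) hz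
  have hle : ∀ X Y : Set α, X ⊆ Y → (G.deleteEdges B).induce X ≤ G.induce Y := by
    intro X Y hXY
    exact ⟨hXY, fun e u v h => ⟨(deleteEdges_isLink_iff.1 h.1).1, hXY h.2.1, hXY h.2.2⟩⟩
  refine ⟨_, hsub x hx, hC.mono (hle _ _ subset_rfl), hD.mono (hle _ _ ?_), ?_⟩
  · intro w hw
    refine ⟨hsub y hy hw, fun hw' => hne ?_⟩
    have hxy : (G.deleteEdges B).Reaches x y := Relation.ReflTransGen.trans hw' (Reaches.symm hw)
    ext z
    exact ⟨fun hz => Relation.ReflTransGen.trans (Reaches.symm hxy) hz,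
      fun hz => Relation.ReflTransGen.trans hxy hz⟩
  · rintro e ⟨u, v, huv, hu, hv⟩
    by_contra heB
    exact hv (Relation.ReflTransGen.tail hu ⟨e, deleteEdges_isLink_iff.2 ⟨huv, heB⟩⟩)

end Connectivity

end Graph

/-! ### Even cubic graphs and canonical decompositions -/

namespace Graph

universe u v

variable {α : Type u} {β : Type v} {G : Graph α β}

/-- A finite cubic graph without edge cuts of size less than three whose order is congruent to `2`
modulo `4`, such that both sides of every edge cut of size three have order congruent to `1`. In
other words, the graph and the sides of its cuts of size three have even Betti number. -/
structure IsEvenCubic (G : Graph α β) : Prop where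
  finite : G.IsFinite
  cubic : G.IsCubic
  three_le_cut : ∀ X ⊆ G.vertexSet, X.Nonempty → (G.vertexSet \ X).Nonempty →
    3 ≤ (G.edgeCut X).ncard
  card_mod : G.vertexSet.ncard % 4 = 2
  mod_of_cut : ∀ X ⊆ G.vertexSet, (G.edgeCut X).ncard = 3 → X.ncard % 4 = 1

theorem IsCubic.two_mul_ncard_edgeSet (hcubic : G.IsCubic) (hG : G.IsFinite) :
    2 * G.edgeSet.ncard = 3 * G.vertexSet.ncard := by
  have h := hcubic.two_mul_ncard_add hG subset_rfl
  rwa [edgeCut_vertexSet, induce_vertexSet, Set.ncard_empty, add_zero] at h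

/-- If `X` fell into two parts with no edge between them, their cuts, each of size at least 3, would
be disjoint subsets of `δ(X)`. -/
theorem isConnected_induce_of_ncard_edgeCut_le (hG : G.IsFinite)
    (hcut : ∀ X ⊆ G.vertexSet, X.Nonempty → (G.vertexSet \ X).Nonempty →
      3 ≤ (G.edgeCut X).ncard) {X : Set α} (hX : X ⊆ G.vertexSet) (hne : X.Nonempty)
    (hle : (G.edgeCut X).ncard ≤ 3) : (G.induce X).IsConnected := by
  by_contra hcon
  obtain ⟨Y, hY, hYne, hYne', hcl⟩ := exists_closed_of_not_isConnected (G := G.induce X) hne hcon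
  change Y ⊆ X at hY
  change (X \ Y).Nonempty at hYne'
  have hcl' : ∀ e u v, G.IsLink e u v → u ∈ Y → v ∈ X → v ∈ Y := fun e u v h hu hv =>
    hcl u v ⟨e, h, hY hu, hv⟩ hu
  have h1 : 3 ≤ (G.edgeCut Y).ncard := hcut Y (hY.trans hX) hYne
    ⟨hYne'.some, hX hYne'.some_mem.1, hYne'.some_mem.2⟩
  have h2 : 3 ≤ (G.edgeCut (X \ Y)).ncard := hcut (X \ Y) (Set.sdiff_subset.trans hX) hYne'
    ⟨hYne.some, hX (hY hYne.some_mem), fun h => h.2 hYne.some_mem⟩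
  have hfin : ∀ Z, (G.edgeCut Z).Finite := fun Z => hG.2.subset (edgeCut_subset_edgeSet G Z)
  have hdisj : Disjoint (G.edgeCut Y) (G.edgeCut (X \ Y)) := by
    rw [Set.disjoint_left]
    rintro e ⟨u, v, h, hu, hv⟩ ⟨a, b, h', ha, hb⟩
    rcases h.eq_and_eq_or_eq_and_eq h' with ⟨rfl, rfl⟩ | ⟨rfl, rfl⟩
    · exact ha.2 hu
    · exact hv (hcl' e _ _ h hu ha.1)
  have hsub : G.edgeCut Y ∪ G.edgeCut (X \ Y) ⊆ G.edgeCut X := by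
    rintro e (⟨u, v, h, hu, hv⟩ | ⟨u, v, h, hu, hv⟩)
    · exact ⟨u, v, h, hY hu, fun hvX => hv (hcl' e u v h hu hvX)⟩
    · exact ⟨u, v, h, hu.1, fun hvX => hv ⟨hvX, fun hvY => hu.2 (hcl' e v u h.symm hvY hu.1)⟩⟩
  have h3 := Set.ncard_le_ncard hsub (hfin X)
  rw [Set.ncard_union_eq hdisj (hfin _) (hfin _)] at h3
  omega

theorem IsCubic.two_le_ncard_of_hasCycle (hcubic : G.IsCubic) (hG : G.IsFinite) {X : Set α}
    (hX : X ⊆ G.vertexSet) (hcut : (G.edgeCut X).ncard = 3) (hcyc : (G.induce X).HasCycle) :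
    2 ≤ X.ncard := by
  obtain ⟨C, hC, hCcyc⟩ := hcyc
  have h1 := hCcyc.ncard_edgeSet
  have h2 : 0 < C.vertexSet.ncard := (Set.ncard_pos hCcyc.1.1).2 hCcyc.2.1.1
  have h3 : C.edgeSet.ncard ≤ (G.induce X).edgeSet.ncard :=
    Set.ncard_le_ncard hC.edgeSet_mono (hG.2.subset (edgeSet_induce_subset G X))
  have h4 := hcubic.two_mul_ncard_add hG hX
  omega

theorem hasCycle_induce_of_ncard_le (hG : G.IsFinite) {X : Set α} (hX : X ⊆ G.vertexSet)
    (hne : X.Nonempty) (h : X.ncard ≤ (G.induce X).edgeSet.ncard) : (G.induce X).HasCycle :=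
  hasCycle_of_ncard_le _ _ (hG.mono (induce_le hX)) hne h rfl

section CloseUp

theorem closeUp_isLink {A : Set α} {x : α} {e : β} {u v : α} :
    (G.closeUp A x).IsLink e u v ↔ ∃ u' v', G.IsLink e u' v' ∧ (u' ∈ A ∨ v' ∈ A) ∧
      (u' ∈ A ∧ u = u' ∨ u' ∉ A ∧ u = x) ∧ (v' ∈ A ∧ v = v' ∨ v' ∉ A ∧ v = x) := by
  classical
  constructor
  · rintro ⟨u', v', ⟨⟨a, haA, ha⟩, h⟩, rfl, rfl⟩
    refine ⟨u', v', h, ?_, ?_, ?_⟩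
    · rcases ha.eq_or_eq_of_isLink h with rfl | rfl <;> simp [haA]
    · by_cases hu : u' ∈ A <;> simp [hu]
    · by_cases hv : v' ∈ A <;> simp [hv]
  · rintro ⟨u', v', h, hor, hu, hv⟩
    refine ⟨u', v', ⟨?_, h⟩, ?_, ?_⟩
    · rcases hor with h' | h'
      exacts [⟨u', h', h.inc_left⟩, ⟨v', h', h.inc_right⟩]
    · rcases hu with ⟨hu, rfl⟩ | ⟨hu, rfl⟩ <;> simp [hu]
    · rcases hv with ⟨hv, rfl⟩ | ⟨hv, rfl⟩ <;> simp [hv]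

theorem vertexSet_closeUp {A : Set α} (hA : A ⊆ G.vertexSet) (hne : (G.vertexSet \ A).Nonempty)
    (x : α) : (G.closeUp A x).vertexSet = insert x A := by
  classical
  ext y
  constructor
  · rintro ⟨z, -, rfl⟩
    by_cases hz : z ∈ A <;> simp [hz]
  · rintro (rfl | hy)
    · exact ⟨hne.some, hne.some_mem.1, if_neg hne.some_mem.2⟩
    · exact ⟨y, hA hy, if_pos hy⟩

/-- Since a cut is also that of the complement, every cut of the closed-up graph has a side avoiding
`x` and so is a cut of `G`. -/
theorem edgeCut_closeUp {A X : Set α} {x : α} (hx : x ∉ A) (hX : X ⊆ A) :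
    (G.closeUp A x).edgeCut X = G.edgeCut X := by
  ext e
  constructor
  · rintro ⟨u, v, h, hu, hv⟩
    obtain ⟨u', v', h, -, hu' | hu', hv'⟩ := closeUp_isLink.1 h
    · obtain ⟨hu', rfl⟩ := hu'
      refine ⟨u, v', h, hu, fun hv'' => ?_⟩
      rcases hv' with ⟨-, rfl⟩ | ⟨h', -⟩
      exacts [hv hv'', h' (hX hv'')]
    · exact (hx (hu'.2 ▸ hX hu)).elim
  · rintro ⟨u, v, h, hu, hv⟩
    by_cases hvA : v ∈ A
    · exact ⟨u, v, closeUp_isLink.2 ⟨u, v, h, Or.inl (hX hu), Or.inl ⟨hX hu, rfl⟩,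
        Or.inl ⟨hvA, rfl⟩⟩, hu, hv⟩
    · exact ⟨u, x, closeUp_isLink.2 ⟨u, v, h, Or.inl (hX hu), Or.inl ⟨hX hu, rfl⟩,
        Or.inr ⟨hvA, rfl⟩⟩, hu, fun h' => hx (hX h')⟩

theorem valency_closeUp_of_mem {A : Set α} {x a : α} (hx : x ∉ A) (ha : a ∈ A) :
    (G.closeUp A x).valency a = G.valency a := by
  have hax : a ≠ x := fun h => hx (h ▸ ha)
  have h1 : (G.closeUp A x).incidenceSet a = G.incidenceSet a := by
    ext e
    constructor
    · rintro ⟨v, h⟩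
      obtain ⟨u', v', h, -, hu' | hu', -⟩ := closeUp_isLink.1 h
      · rw [hu'.2]; exact ⟨v', h⟩
      · exact (hax hu'.2).elim
    · rintro ⟨v, h⟩
      by_cases hv : v ∈ A
      · exact ⟨v, closeUp_isLink.2 ⟨a, v, h, Or.inl ha, Or.inl ⟨ha, rfl⟩, Or.inl ⟨hv, rfl⟩⟩⟩
      · exact ⟨x, closeUp_isLink.2 ⟨a, v, h, Or.inl ha, Or.inl ⟨ha, rfl⟩, Or.inr ⟨hv, rfl⟩⟩⟩
  have h2 : (G.closeUp A x).loopSet a = G.loopSet a := by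
    ext e
    constructor
    · intro h
      obtain ⟨u', v', h, -, hu' | hu', hv' | hv'⟩ := closeUp_isLink.1 h
      · rw [← hu'.2, ← hv'.2] at h; exact h
      all_goals simp_all
    · intro h
      exact closeUp_isLink.2 ⟨a, a, h, Or.inl ha, Or.inl ⟨ha, rfl⟩, Or.inl ⟨ha, rfl⟩⟩
  rw [valency, valency, h1, h2]

theorem valency_closeUp_self {A : Set α} {x : α} (hx : x ∉ A) :
    (G.closeUp A x).valency x = (G.edgeCut A).encard := by
  have h1 : (G.closeUp A x).incidenceSet x = G.edgeCut A := by
    ext e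
    constructor
    · rintro ⟨v, h⟩
      obtain ⟨u', v', h, hor, hu' | hu', -⟩ := closeUp_isLink.1 h
      · exact (hx (hu'.2 ▸ hu'.1)).elim
      · exact ⟨v', u', h.symm, hor.resolve_left hu'.1, hu'.1⟩
    · rintro ⟨u, v, h, hu, hv⟩
      exact ⟨u, closeUp_isLink.2 ⟨v, u, h.symm, Or.inr hu, Or.inr ⟨hv, rfl⟩, Or.inl ⟨hu, rfl⟩⟩⟩
  have h2 : (G.closeUp A x).loopSet x = ∅ := by
    ext e
    simp only [mem_loopSet, Set.mem_empty_iff_false, iff_false]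
    intro h
    obtain ⟨u', v', h, hor, hu' | hu', hv' | hv'⟩ := closeUp_isLink.1 h
    all_goals simp_all
  rw [valency, h1, h2, Set.encard_empty, add_zero]

theorem IsEvenCubic.closeUp (hG : G.IsEvenCubic) {A : Set α} {x : α} (hA : A ⊆ G.vertexSet)
    (hne : (G.vertexSet \ A).Nonempty) (hx : x ∉ A) (hcut : (G.edgeCut A).ncard = 3) :
    (G.closeUp A x).IsEvenCubic := by
  have hV := vertexSet_closeUp hA hne x
  have hAfin := hG.finite.1.subset hA
  have hcompl : ∀ X ⊆ (G.closeUp A x).vertexSet, x ∈ X →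
      (G.closeUp A x).vertexSet \ X ⊆ A := by
    intro X _ hxX y hy
    rw [hV] at hy
    exact hy.1.resolve_left fun h => hy.2 (h ▸ hxX)
  have hnotin : ∀ X ⊆ (G.closeUp A x).vertexSet, x ∉ X → X ⊆ A := by
    intro X hX hxX y hy
    have h := hX hy
    rw [hV] at h
    exact h.resolve_left fun h => hxX (h ▸ hy)
  have hdiff : ∀ X ⊆ A, (G.vertexSet \ X).Nonempty := fun X hX =>
    ⟨hne.some, hne.some_mem.1, fun h => hne.some_mem.2 (hX h)⟩
  have hcard : (G.closeUp A x).vertexSet.ncard = A.ncard + 1 := by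
    rw [hV, Set.ncard_insert_of_notMem hx hAfin]
  have hmodA := hG.mod_of_cut A hA hcut
  have hfinV : (G.closeUp A x).vertexSet.Finite := by
    rw [hV]
    exact hAfin.insert x
  refine ⟨⟨hfinV, hG.finite.2.subset fun e he => ?_⟩, ?_, ?_, by omega, ?_⟩
  · obtain ⟨u, v, h⟩ := exists_isLink_of_mem_edgeSet he
    obtain ⟨u', v', h, -⟩ := closeUp_isLink.1 h
    exact h.edge_mem
  · intro y hy
    rw [hV] at hy
    rcases hy with rfl | hy
    · rw [valency_closeUp_self hx,
        ← (hG.finite.2.subset (edgeCut_subset_edgeSet G A)).cast_ncard_eq, hcut]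
      rfl
    · rw [valency_closeUp_of_mem hx hy]
      exact hG.cubic y (hA hy)
  · intro X hX hXne hXne'
    by_cases hxX : x ∈ X
    · have h := hcompl X hX hxX
      rw [← edgeCut_diff, edgeCut_closeUp hx h]
      exact hG.three_le_cut _ (h.trans hA) hXne' (hdiff _ h)
    · have h := hnotin X hX hxX
      rw [edgeCut_closeUp hx h]
      exact hG.three_le_cut _ (h.trans hA) hXne (hdiff _ h)
  -- If `x` is in `X`, the complementary side has order 1 modulo 4; as the new graph has order `|A|
  -- + 1`, which is 2 modulo 4, so does `X`.
  · intro X hX h3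
    by_cases hxX : x ∈ X
    · have h := hcompl X hX hxX
      rw [← edgeCut_diff, edgeCut_closeUp hx h] at h3
      have h4 := hG.mod_of_cut _ (h.trans hA) h3
      have h5 := Set.ncard_sdiff_add_ncard_of_subset hX hfinV
      omega
    · have h := hnotin X hX hxX
      rw [edgeCut_closeUp hx h] at h3
      exact hG.mod_of_cut _ (h.trans hA) h3

end CloseUp

theorem IsEvenCubic.even_bettiNumber (hG : G.IsEvenCubic) : Even G.bettiNumber := by
  have h1 := hG.cubic.two_mul_ncard_edgeSet hG.finite
  have h2 := hG.card_mod
  rw [bettiNumber, Int.even_iff]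
  omega

theorem IsCanonicalDecomposition.isEvenCubic {L : Multiset (Graph α β)}
    (hL : G.IsCanonicalDecomposition L) (hG : G.IsEvenCubic) : ∀ K ∈ L, K.IsEvenCubic := by
  induction hL with
  | factor G _ =>
    intro K hK
    rwa [Multiset.mem_singleton.1 hK]
  | split G A B x y L M hV hAB hA hB hA' hB' hcut hx hy _ _ ihL ihM =>
    have hAV : A ⊆ G.vertexSet := hV ▸ Set.subset_union_left
    have hBV : B ⊆ G.vertexSet := hV ▸ Set.subset_union_right
    have hBA : G.vertexSet \ A = B := by
      rw [← hV, Set.union_sdiff_left, hAB.symm.sdiff_eq_left]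
    have hAB' : G.vertexSet \ B = A := by
      rw [← hV, Set.union_sdiff_right, hAB.sdiff_eq_left]
    have hcut' : (G.edgeCut A).ncard = 3 := by
      rw [Set.ncard, hcut]; rfl
    have hcutB : (G.edgeCut B).ncard = 3 := by
      rw [← hBA, edgeCut_diff, hcut']
    intro K hK
    rcases Multiset.mem_add.1 hK with hK | hK
    · exact ihL (hG.closeUp hAV (hBA ▸ hB'.nonempty) hx hcut') K hK
    · exact ihM (hG.closeUp hBV (hAB' ▸ hA'.nonempty) hy hcutB) K hK

theorem IsEvenCubic.isConnected (hG : G.IsEvenCubic) : G.IsConnected := by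
  have h := isConnected_induce_of_ncard_edgeCut_le hG.finite hG.three_le_cut subset_rfl
    (Set.nonempty_of_ncard_ne_zero (by have := hG.card_mod; omega))
    (by rw [edgeCut_vertexSet, Set.ncard_empty]; omega)
  rwa [induce_vertexSet] at h

/-- A cubic graph without edge cuts of size less than three that is not cyclically
4-edge-connected has an edge cut of size three with nontrivial sides. -/
theorem exists_nontrivial_cut (hG : G.IsFinite) (hcubic : G.IsCubic)
    (hcut : ∀ X ⊆ G.vertexSet, X.Nonempty → (G.vertexSet \ X).Nonempty →
      3 ≤ (G.edgeCut X).ncard) (hconn : G.IsConnected) (h4 : ¬ G.CyclicallyEdgeConnected 4) :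
    ∃ X ⊆ G.vertexSet, (G.edgeCut X).ncard = 3 ∧ 2 ≤ X.ncard ∧
      2 ≤ (G.vertexSet \ X).ncard := by
  simp only [CyclicallyEdgeConnected, hconn, true_and] at h4
  push Not at h4
  obtain ⟨B, hB, hlt⟩ := h4
  obtain ⟨X, hX, h1, h2, h3⟩ := hB.exists_edgeCut_subset
  have hne : X.Nonempty := by
    obtain ⟨C, hC, hCcyc⟩ := h1
    exact ⟨_, hC.vertexSet_mono hCcyc.2.1.1.some_mem⟩
  have hne' : (G.vertexSet \ X).Nonempty := by
    obtain ⟨C, hC, hCcyc⟩ := h2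
    exact ⟨_, hC.vertexSet_mono hCcyc.2.1.1.some_mem⟩
  have h5 := hcut X hX hne hne'
  have h6 : (G.edgeCut X).ncard < 4 := by
    have h7 : ((G.edgeCut X).ncard : ℕ∞) < (4 : ℕ) := by
      rw [(hG.2.subset (edgeCut_subset_edgeSet G X)).cast_ncard_eq]
      exact (Set.encard_le_encard h3).trans_lt hlt
    exact_mod_cast h7
  have h7 : (G.edgeCut X).ncard = 3 := by omega
  exact ⟨X, hX, h7, hcubic.two_le_ncard_of_hasCycle hG hX h7 h1,
    hcubic.two_le_ncard_of_hasCycle hG Set.sdiff_subset (by rw [edgeCut_diff, h7]) h2⟩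

theorem IsEvenCubic.exists_isCanonicalDecomposition (n : ℕ) :
    ∀ G : Graph α β, G.IsEvenCubic → G.vertexSet.ncard = n →
      ∃ L, G.IsCanonicalDecomposition L := by
  induction n using Nat.strong_induction_on with
  | _ n ih =>
  intro G hG hn
  by_cases h4 : G.CyclicallyEdgeConnected 4
  · exact ⟨_, .factor G h4⟩
  obtain ⟨A, hA, hcut, hA2, hB2⟩ := exists_nontrivial_cut hG.finite hG.cubic hG.three_le_cut
    hG.isConnected h4
  have hB : G.vertexSet \ A ⊆ G.vertexSet := Set.sdiff_subset
  have hcutB : (G.edgeCut (G.vertexSet \ A)).ncard = 3 := by rw [edgeCut_diff, hcut]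
  have := (hG.finite.1.subset hA).to_subtype
  have := (hG.finite.1.subset hB).to_subtype
  have hAnt : A.Nontrivial := Set.one_lt_ncard_iff_nontrivial.1 hA2
  have hBnt : (G.vertexSet \ A).Nontrivial := Set.one_lt_ncard_iff_nontrivial.1 hB2
  -- The type `α` may have no element outside `G`, so each side is closed up with a vertex of the
  -- other side. The closed-up graphs are smaller because both sides have at least two vertices.
  obtain ⟨x, hx⟩ := hBnt.nonempty
  obtain ⟨y, hy⟩ := hAnt.nonempty
  have hAA : G.vertexSet \ (G.vertexSet \ A) = A := Set.sdiff_sdiff_cancel_left hA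
  have hcard := Set.ncard_sdiff_add_ncard_of_subset hA hG.finite.1
  have hne : (G.vertexSet \ (G.vertexSet \ A)).Nonempty := hAA.symm ▸ hAnt.nonempty
  have hy' : y ∉ G.vertexSet \ A := fun h => h.2 hy
  obtain ⟨L, hL⟩ := ih _ (by
    rw [vertexSet_closeUp hA hBnt.nonempty x,
      Set.ncard_insert_of_notMem hx.2 (hG.finite.1.subset hA)]
    omega) _ (hG.closeUp hA hBnt.nonempty hx.2 hcut) rfl
  obtain ⟨M, hM⟩ := ih _ (by
    rw [vertexSet_closeUp hB hne y,
      Set.ncard_insert_of_notMem hy' (hG.finite.1.subset hB)]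
    omega) _ (hG.closeUp hB hne hy' hcutB) rfl
  refine ⟨L + M, .split G A (G.vertexSet \ A) x y L M (Set.union_sdiff_cancel hA)
    Set.disjoint_sdiff_right ?_ ?_ hAnt hBnt ?_ hx.2 hy' hL hM⟩
  · exact isConnected_induce_of_ncard_edgeCut_le hG.finite hG.three_le_cut hA hAnt.nonempty hcut.le
  · exact isConnected_induce_of_ncard_edgeCut_le hG.finite hG.three_le_cut hB hBnt.nonempty hcutB.le
  · rw [← (hG.finite.2.subset (edgeCut_subset_edgeSet G A)).cast_ncard_eq, hcut]
    rfl

/-- The cut condition leaves no loops and at most one edge per pair. A triple of vertices has the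
cut of a single vertex, of size 3, hence three inner edges; so no two of its vertices can be
nonadjacent. -/
theorem isK4_of_ncard_eq_four (hG : G.IsFinite) (hcubic : G.IsCubic)
    (hcut : ∀ X ⊆ G.vertexSet, X.Nonempty → (G.vertexSet \ X).Nonempty →
      3 ≤ (G.edgeCut X).ncard) (h4 : G.vertexSet.ncard = 4) : G.IsK4 := by
  have hfin : ∀ X, (G.induce X).edgeSet.Finite := fun X =>
    hG.2.subset (edgeSet_induce_subset G X)
  have hcut' : ∀ X ⊆ G.vertexSet, 0 < X.ncard → X.ncard < 4 → 3 ≤ (G.edgeCut X).ncard := by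
    intro X hX h0 hlt
    have h1 := Set.ncard_sdiff_add_ncard_of_subset hX hG.1
    exact hcut X hX (Set.nonempty_of_ncard_ne_zero (by omega))
      (Set.nonempty_of_ncard_ne_zero (by omega))
  have hnoloop : ∀ e x, ¬ G.IsLoopAt e x := by
    intro e x h
    have hx : {x} ⊆ G.vertexSet := by simpa using h.vertex_mem
    have h1 := hcubic.two_mul_ncard_add hG hx
    have h2 := hcut' {x} hx (by simp) (by simp)
    have h3 : 0 < (G.induce {x}).edgeSet.ncard :=
      (Set.ncard_pos (hfin _)).2 ⟨e, x, x, h, rfl, rfl⟩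
    rw [Set.ncard_singleton] at h1
    omega
  have hpair : ∀ x ∈ G.vertexSet, ∀ y ∈ G.vertexSet, x ≠ y →
      (G.induce {x, y}).edgeSet.ncard ≤ 1 := by
    intro x hx y hy hne
    have hxy : {x, y} ⊆ G.vertexSet := Set.pair_subset hx hy
    have h1 := hcubic.two_mul_ncard_add hG hxy
    have h2 := hcut' _ hxy (by rw [Set.ncard_pair hne]; omega) (by rw [Set.ncard_pair hne]; omega)
    rw [Set.ncard_pair hne] at h1
    omega
  refine ⟨{ not_isLoopAt := hnoloop, eq_of_isLink := ?_ }, ?_, ?_⟩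
  · intro e f x y he hf
    by_cases hxy : x = y
    · subst hxy
      exact (hnoloop e x he).elim
    · have h1 := hpair x he.left_mem y he.right_mem hxy
      rw [Set.ncard_le_one (hfin _)] at h1
      exact h1 e ⟨x, y, he, by simp, by simp⟩ f ⟨x, y, hf, by simp, by simp⟩
  · rw [← hG.1.cast_ncard_eq, h4]
    rfl
  · intro x hx y hy hxy
    by_contra hadj
    obtain ⟨z, hz, hzxy⟩ : (G.vertexSet \ {x, y}).Nonempty := by
      refine Set.nonempty_of_ncard_ne_zero ?_
      have := Set.ncard_sdiff_add_ncard_of_subset (Set.pair_subset hx hy) hG.1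
      rw [Set.ncard_pair hxy] at this
      omega
    simp only [Set.mem_insert_iff, Set.mem_singleton_iff, not_or] at hzxy
    have hT : ({x, y, z} : Set α) ⊆ G.vertexSet := by
      rintro w (rfl | rfl | rfl) <;> assumption
    have hTcard : ({x, y, z} : Set α).ncard = 3 :=
      Set.ncard_eq_three.2 ⟨x, y, z, hxy, Ne.symm hzxy.1, Ne.symm hzxy.2, rfl⟩
    have hTcompl := Set.ncard_sdiff_add_ncard_of_subset hT hG.1
    have h1 := hcubic.two_mul_ncard_add hG hT
    have h2 := hcubic.two_mul_ncard_add hG (X := G.vertexSet \ {x, y, z}) Set.sdiff_subset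
    rw [edgeCut_diff] at h2
    have h3 : (G.induce {x, y, z}).edgeSet ⊆
        (G.induce {x, z}).edgeSet ∪ (G.induce {y, z}).edgeSet := by
      rintro e ⟨u, v, h, hu, hv⟩
      have hxy' : ∀ e, ¬ G.IsLink e x y := fun e h => hadj ⟨e, h⟩
      have hyx' : ∀ e, ¬ G.IsLink e y x := fun e h => hadj ⟨e, h.symm⟩
      rcases hu with rfl | rfl | rfl <;> rcases hv with rfl | rfl | rfl
      · exact (hnoloop _ _ h).elim
      · exact (hxy' _ h).elim
      · exact Or.inl ⟨_, _, h, by simp, by simp⟩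
      · exact (hyx' _ h).elim
      · exact (hnoloop _ _ h).elim
      · exact Or.inr ⟨_, _, h, by simp, by simp⟩
      · exact Or.inl ⟨_, _, h, by simp, by simp⟩
      · exact Or.inr ⟨_, _, h, by simp, by simp⟩
      · exact (hnoloop _ _ h).elim
    have h4 := Set.ncard_le_ncard h3 ((hfin _).union (hfin _))
    have h5 := Set.ncard_union_le (G.induce {x, z}).edgeSet (G.induce {y, z}).edgeSet
    have h6 := hpair x hx z hz (Ne.symm hzxy.1)
    have h7 := hpair y hy z hz (Ne.symm hzxy.2)
    omega

theorem cyclicConnectivity_eq_three (h : G.cyclicConnectivity = 3) :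
    3 ≤ G.bettiNumber ∧ G.CyclicallyEdgeConnected 3 ∧
      ¬ (4 ≤ G.bettiNumber ∧ G.CyclicallyEdgeConnected 4) := by
  have hbdd : BddAbove {k : ℕ | (k : ℤ) ≤ G.bettiNumber ∧ G.CyclicallyEdgeConnected k} :=
    ⟨G.bettiNumber.toNat, fun k hk => by have := hk.1; omega⟩
  -- The supremum of the empty set is 0, not 3.
  have hne : {k : ℕ | (k : ℤ) ≤ G.bettiNumber ∧ G.CyclicallyEdgeConnected k}.Nonempty := by
    by_contra hemp
    rw [Set.not_nonempty_iff_eq_empty] at hemp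
    rw [cyclicConnectivity, hemp] at h
    simp at h
  have hmem := Nat.sSup_mem hne hbdd
  rw [cyclicConnectivity] at h
  rw [h] at hmem
  refine ⟨by exact_mod_cast hmem.1, hmem.2, fun h4 => ?_⟩
  have := le_csSup hbdd (a := 4) ⟨by exact_mod_cast h4.1, h4.2⟩
  omega

theorem isEvenCubic_of_oddCyclicallyConnected (hfin : G.IsFinite) (hcubic : G.IsCubic)
    (hodd : G.OddCyclicallyConnected 4) (hconn : G.cyclicConnectivity = 3) (hK4 : ¬ G.IsK4) :
    G.IsEvenCubic := by
  obtain ⟨hbetti, hcyc3, hcyc4⟩ := cyclicConnectivity_eq_three hconn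
  have hcutfin : ∀ X, (G.edgeCut X).Finite := fun X =>
    hfin.2.subset (edgeCut_subset_edgeSet G X)
  have hcut : ∀ X ⊆ G.vertexSet, X.Nonempty → (G.vertexSet \ X).Nonempty →
      3 ≤ (G.edgeCut X).ncard := by
    -- By the degree count, a side of a cut of size at most 2 has at least as many edges as
    -- vertices, hence a cycle. Such a cut would be cycle-separating, against cyclic
    -- 3-edge-connectivity.
    intro X hX hne hne'
    by_contra hlt
    have h1 := hcubic.two_mul_ncard_add hfin hX
    have h2 := hcubic.two_mul_ncard_add hfin (X := G.vertexSet \ X) Set.sdiff_subset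
    rw [edgeCut_diff] at h2
    have h3 := (Set.ncard_pos (hfin.1.subset hX)).2 hne
    have h4 := (Set.ncard_pos (hfin.1.subset Set.sdiff_subset)).2 hne'
    have h5 := hcyc3.2 _ (isCycleSeparating_edgeCut
      (hasCycle_induce_of_ncard_le hfin hX hne (by omega)) hX
      (hasCycle_induce_of_ncard_le hfin Set.sdiff_subset hne' (by omega)))
    rw [← (hcutfin X).cast_ncard_eq] at h5
    exact hlt (by exact_mod_cast h5)
  have hmod : ∀ X ⊆ G.vertexSet, (G.edgeCut X).ncard = 3 → 2 ≤ X.ncard →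
      2 ≤ (G.vertexSet \ X).ncard → X.ncard % 4 = 1 := by
    intro X hX h3 hX2 hY2
    have hne : X.Nonempty := Set.nonempty_of_ncard_ne_zero (by omega)
    have hne' : (G.vertexSet \ X).Nonempty := Set.nonempty_of_ncard_ne_zero (by omega)
    have h1 := hcubic.two_mul_ncard_add hfin hX
    have h2 := hcubic.two_mul_ncard_add hfin (X := G.vertexSet \ X) Set.sdiff_subset
    rw [edgeCut_diff] at h2
    have h4 := hodd X hX (isConnected_induce_of_ncard_edgeCut_le hfin hcut hX hne h3.le)
      (isCycleSeparating_edgeCut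
        (hasCycle_induce_of_ncard_le hfin hX hne (by omega)) hX
        (hasCycle_induce_of_ncard_le hfin Set.sdiff_subset hne' (by omega)))
    rw [← (hcutfin X).cast_ncard_eq, h3] at h4
    have h5 : ¬ Odd (G.induce X).bettiNumber := by
      intro h
      have h6 := h4 h
      have h7 : 4 ≤ 3 := by exact_mod_cast h6
      omega
    rw [Int.not_odd_iff_even, bettiNumber, Int.even_iff] at h5
    change (((G.induce X).edgeSet.ncard : ℤ) - (X.ncard : ℤ) + 1) % 2 = 0 at h5
    omega
  have hcard := hcubic.two_mul_ncard_edgeSet hfin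
  -- Cyclic connectivity 3 could also result from the cap by the Betti number. Betti number 3 means
  -- four vertices, hence `K₄`.
  have h4 : ¬ G.CyclicallyEdgeConnected 4 := by
    intro h4
    have h5 : G.bettiNumber = 3 := by
      have : ¬ 4 ≤ G.bettiNumber := fun h => hcyc4 ⟨h, h4⟩
      omega
    rw [bettiNumber] at h5
    exact hK4 (isK4_of_ncard_eq_four hfin hcubic hcut (by omega))
  obtain ⟨X, hX, hX3, hX2, hY2⟩ := exists_nontrivial_cut hfin hcubic hcut hcyc3.1 h4
  have hVmod : G.vertexSet.ncard % 4 = 2 := by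
    have h1 := hmod X hX hX3 hX2 hY2
    have h2 := hmod (G.vertexSet \ X) Set.sdiff_subset (by rw [edgeCut_diff, hX3]) hY2
      (by rwa [Set.sdiff_sdiff_cancel_left hX])
    have h3 := Set.ncard_sdiff_add_ncard_of_subset hX hfin.1
    omega
  refine ⟨hfin, hcubic, hcut, hVmod, fun Y hY hY3 => ?_⟩
  have h1 := hcubic.two_mul_ncard_add hfin hY
  have h2 := Set.ncard_sdiff_add_ncard_of_subset hY hfin.1
  by_cases hYs : Y.ncard ≤ 1
  -- Trivial sides: a single vertex has order 1, and its complement has order `|V| - 1`, which is 1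
  -- modulo 4.
  · omega
  by_cases hYc : (G.vertexSet \ Y).ncard ≤ 1
  · have h3 := hcubic.two_mul_ncard_add hfin (X := G.vertexSet \ Y) Set.sdiff_subset
    rw [edgeCut_diff] at h3
    omega
  · exact hmod Y hY hY3 (by omega) (by omega)

end Graph

/-! ### From the orientation to the coherent decycling partition -/

namespace Graph

universe u v

variable {α : Type u} {β : Type v} {G : Graph α β}

section Orientation

open Finset

theorem ncard_edgeSet_induce_eq_innerCard {s t : β → α}
    (hst : ∀ e ∈ G.edgeSet, G.IsLink e (s e) (t e)) {E : Finset β} (hE : (E : Set β) = G.edgeSet)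
    (X : Finset α) : (G.induce X).edgeSet.ncard = innerCard s t E X := by
  classical
  rw [innerCard_eq, ← Set.ncard_coe_finset]
  congr 1
  have hmem : ∀ e, e ∈ E ↔ e ∈ G.edgeSet := fun e => by rw [← hE]; rfl
  ext e
  simp only [edgeSet_induce, coe_filter, Set.mem_ofPred_eq, mem_coe, hmem]
  constructor
  · rintro ⟨x, y, h, hx, hy⟩
    refine ⟨h.edge_mem, ?_⟩
    rcases (hst e h.edge_mem).eq_and_eq_or_eq_and_eq h with ⟨h1, h2⟩ | ⟨h1, h2⟩ <;>
      rw [h1, h2] <;> exact ⟨by assumption, by assumption⟩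
  · rintro ⟨he, h⟩
    exact ⟨_, _, hst e he, h⟩

/-- The edges of `G` can be oriented from `k` to `h` in such a way that the root has even in-degree,
all other vertices have odd in-degree and all vertices are reached from the root. -/
theorem IsEvenCubic.exists_parityOrientation [DecidableEq α] (hG : G.IsEvenCubic) {r : α}
    (hr : r ∈ G.vertexSet) :
    ∃ h k : β → α, (∀ e ∈ G.edgeSet, G.IsLink e (k e) (h e)) ∧
      (∀ v ∈ G.vertexSet,
        Set.ncard {e | e ∈ G.edgeSet ∧ h e = v} % 2 = if v = r then 0 else 1) ∧
      ∀ Z ⊆ G.vertexSet, Z.Nonempty → r ∉ Z → ∃ e ∈ G.edgeSet, h e ∈ Z ∧ k e ∉ Z := by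
  classical
  have : Nonempty α := ⟨r⟩
  obtain ⟨s, t, hst⟩ := exists_ends G
  set V : Finset α := hG.finite.1.toFinset with hVdef
  set E : Finset β := hG.finite.2.toFinset with hEdef
  have hV : (V : Set α) = G.vertexSet := by simp [hVdef]
  have hE : (E : Set β) = G.edgeSet := by simp [hEdef]
  have hmemV : ∀ v, v ∈ V ↔ v ∈ G.vertexSet := fun v => by simp [hVdef]
  have hmemE : ∀ e, e ∈ E ↔ e ∈ G.edgeSet := fun e => by simp [hEdef]
  have hVcard : G.vertexSet.ncard = #V := by rw [← hV, Set.ncard_coe_finset]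
  have hEcard : G.edgeSet.ncard = #E := by rw [← hE, Set.ncard_coe_finset]
  have hcount := hG.cubic.two_mul_ncard_edgeSet hG.finite
  have hmod := hG.card_mod
  rw [hVcard] at hmod
  rw [hVcard, hEcard] at hcount
  have hτ : ∀ X : Finset α, ∑ v ∈ X, (if v = r then 0 else 1) + (if r ∈ X then 1 else 0) = #X := by
    intro X
    rw [← sum_ite_eq' X r fun _ => 1, ← sum_add_distrib, card_eq_sum_ones]
    exact sum_congr rfl fun v _ => by split_ifs <;> rfl
  have hrV : r ∈ V := (hmemV r).2 hr
  -- Write `i` for the number of inner edges, so `2 i + |δ(X)| = 3 |X|`. A cut of size at least 4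
  -- allows demand `i + 2`. For a cut of size 3 only `i + 1` fits: this is enough if `r` is in `X`,
  -- and otherwise `|X|` being 1 modulo 4 makes `i` even and `i + 1` of the right parity. For `X =
  -- V`, the odd number `|E|` has the parity of `|V| - 1`. Summing over a partition gives `2 |E|` on
  -- the right.
  have hclass : ∀ X ⊆ V, X.Nonempty →
      2 * demand s t E (fun v => if v = r then 0 else 1) r X ≤ 3 * #X := by
    intro X hXV hne
    have hX : (X : Set α) ⊆ G.vertexSet := by rw [← hV]; exact_mod_cast hXV
    have h1 := hG.cubic.two_mul_ncard_add hG.finite hX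
    rw [ncard_edgeSet_induce_eq_innerCard hst hE, Set.ncard_coe_finset] at h1
    have h2 := hτ X
    have h3 := hG.mod_of_cut X hX
    rw [Set.ncard_coe_finset] at h3
    by_cases hrX : r ∈ X
    · rw [if_pos hrX] at h2
      by_cases hXeq : X = V
      · have h4 : G.edgeCut (X : Set α) = ∅ := by rw [hXeq, hV, edgeCut_vertexSet]
        rw [h4, Set.ncard_empty] at h1
        have h5 : #X = #V := by rw [hXeq]
        have h6 := demand_le (s := s) (t := t) (E := E) (τ := fun v => if v = r then 0 else 1)
          (r := r) (X := X) le_rfl (fun h => absurd hrX h) (by omega)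
        omega
      · have h4 := hG.three_le_cut X hX (by exact_mod_cast hne) (by
          rw [Set.sdiff_nonempty]
          intro h5
          rw [← hV] at h5
          exact hXeq (hXV.antisymm (by exact_mod_cast h5)))
        have h5 := demand_le_of_mem s t E (fun v => if v = r then 0 else 1) hrX
        omega
    · rw [if_neg hrX] at h2
      have h4 := hG.three_le_cut X hX (by exact_mod_cast hne) ⟨r, hr, by simpa using hrX⟩
      by_cases h5 : (G.edgeCut (X : Set α)).ncard = 3
      · have h6 := h3 h5
        have h7 := demand_le (s := s) (t := t) (E := E) (τ := fun v => if v = r then 0 else 1)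
          (r := r) (X := X) (m := innerCard s t E X + 1) (by omega) (fun _ => le_rfl) (by omega)
        omega
      · have h6 := demand_le_add_two s t E (fun v => if v = r then 0 else 1) r X
        omega
  obtain ⟨h, k, h1, h2, h3⟩ := Graph.exists_parityOrientation s t _ V E
    (fun v => if v = r then 0 else 1) r rfl hrV
    (fun e he => ⟨(hmemV _).2 (hst e ((hmemE e).1 he)).left_mem,
      (hmemV _).2 (hst e ((hmemE e).1 he)).right_mem⟩)
    (by have := hτ V; rw [if_pos hrV] at this; omega)
    (by
      intro P hP
      have h4 := sum_le_sum fun X hX => hclass X (hP.subset hX) (hP.1 X hX)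
      have h5 := hP.sum_sum fun _ => 1
      simp only [← card_eq_sum_ones] at h5
      rw [← mul_sum, ← mul_sum, h5] at h4
      omega)
  refine ⟨h, k, fun e he => ?_, fun v hv => ?_, fun Z hZ hne hrZ => ?_⟩
  · rcases h1 e ((hmemE e).2 he) with ⟨h4, h5⟩ | ⟨h4, h5⟩ <;> rw [h4, h5]
    exacts [(hst e he).symm, hst e he]
  · have h4 := h2 v ((hmemV v).2 hv)
    simp only [hmemE] at h4
    rw [h4]
    split_ifs <;> rfl
  · have hZfin := hG.finite.1.subset hZ
    obtain ⟨e, he, h4, h5⟩ := h3 hZfin.toFinset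
      (fun v hv => (hmemV v).2 (hZ (hZfin.mem_toFinset.1 hv)))
      (by simpa using hne) (by simpa using hrZ)
    exact ⟨e, (hmemE e).1 he, by simpa using h4, by simpa using h5⟩

theorem ncard_indegree_add_outdegree {h k : β → α} (hfin : G.IsFinite) (hcubic : G.IsCubic)
    (hk : ∀ e ∈ G.edgeSet, G.IsLink e (k e) (h e)) {v : α} (hv : v ∈ G.vertexSet) :
    Set.ncard {e | e ∈ G.edgeSet ∧ k e = v} + Set.ncard {e | e ∈ G.edgeSet ∧ h e = v} = 3 := by
  classical
  obtain ⟨E, hE⟩ := hfin.2.exists_finset_coe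
  have hmem : ∀ e, e ∈ E ↔ e ∈ G.edgeSet := fun e => by rw [← hE]; rfl
  have h1 := valency_eq_card hk hE v
  rw [hcubic v hv, ← ncard_setOf_mem_and E k v, ← ncard_setOf_mem_and E h v] at h1
  simp only [hmem] at h1
  exact_mod_cast h1.symm

/-- The vertex set `J` is independent and an orientation from `k` to `h` makes the graph induced by
its complement an arborescence with root `ρ`. -/
structure IsArborescenceOff (G : Graph α β) (J : Set α) (ρ : α) (h k : β → α) : Prop where
  subset : J ⊆ G.vertexSet
  root_mem : ρ ∈ G.vertexSet \ J
  isLink : ∀ e ∈ G.edgeSet, G.IsLink e (k e) (h e)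
  independent : ∀ e ∈ G.edgeSet, k e ∈ J → h e ∉ J
  entered : ∀ Z ⊆ G.vertexSet \ J, Z.Nonempty → ρ ∉ Z →
    ∃ e ∈ G.edgeSet, h e ∈ Z ∧ k e ∈ (G.vertexSet \ J) \ Z
  injOn : ∀ e ∈ G.edgeSet, ∀ f ∈ G.edgeSet, h e ∈ G.vertexSet \ J → h e = h f → e = f
  ne_root : ∀ e ∈ G.edgeSet, k e ∈ G.vertexSet \ J → h e ≠ ρ

theorem IsEvenCubic.exists_isArborescenceOff (hG : G.IsEvenCubic) :
    ∃ J ρ h k, G.IsArborescenceOff J ρ h k := by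
  classical
  obtain ⟨r, hr⟩ : G.vertexSet.Nonempty :=
    Set.nonempty_of_ncard_ne_zero (by have := hG.card_mod; omega)
  obtain ⟨h, k, hk, hpar, hcut⟩ := hG.exists_parityOrientation hr
  have hdeg := fun v (hv : v ∈ G.vertexSet) =>
    ncard_indegree_add_outdegree hG.finite hG.cubic hk hv
  set ind : α → ℕ := fun v => Set.ncard {e | e ∈ G.edgeSet ∧ h e = v} with hind
  set out : α → ℕ := fun v => Set.ncard {e | e ∈ G.edgeSet ∧ k e = v} with hout
  change ∀ v ∈ G.vertexSet, out v + ind v = 3 at hdeg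
  change ∀ v ∈ G.vertexSet, ind v % 2 = if v = r then 0 else 1 at hpar
  have hfin : ∀ (f : β → α) (v : α), {e | e ∈ G.edgeSet ∧ f e = v}.Finite := fun f v =>
    hG.finite.2.subset fun e he => he.1
  have hind_pos : ∀ e ∈ G.edgeSet, 0 < ind (h e) := fun e he =>
    (Set.ncard_pos (hfin h _)).2 ⟨e, he, rfl⟩
  have hout_pos : ∀ e ∈ G.edgeSet, 0 < out (k e) := fun e he =>
    (Set.ncard_pos (hfin k _)).2 ⟨e, he, rfl⟩
  have hunique : ∀ (f : β → α), ∀ e ∈ G.edgeSet, ∀ e' ∈ G.edgeSet, f e = f e' →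
      Set.ncard {e'' | e'' ∈ G.edgeSet ∧ f e'' = f e} ≤ 1 → e = e' := by
    intro f e he e' he' hee hle
    rw [Set.ncard_le_one (hfin f _)] at hle
    exact hle e ⟨he, rfl⟩ e' ⟨he', hee.symm⟩
  have hkmem : ∀ e ∈ G.edgeSet, k e ∈ G.vertexSet := fun e he => (hk e he).left_mem
  have hnosink : ∀ e ∈ G.edgeSet, ind (k e) ≠ 3 := by
    intro e he h3
    have h1 := hdeg _ (hkmem e he)
    have h2 := hout_pos e he
    omega
  have hodd : ∀ v ∈ G.vertexSet, v ≠ r → ind v = 1 ∨ ind v = 3 := by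
    intro v hv hne
    have h1 := hpar v hv
    rw [if_neg hne] at h1
    have h2 := hdeg v hv
    omega
  have hrpar := hpar r hr
  rw [if_pos rfl] at hrpar
  have hrdeg := hdeg r hr
  by_cases hr0 : ind r = 0
  · refine ⟨{v | v ∈ G.vertexSet ∧ ind v = 3}, r, h, k, fun v hv => hv.1, ⟨hr, ?_⟩, hk, ?_, ?_,
      ?_, ?_⟩
    · rintro ⟨-, h3⟩
      omega
    · intro e he hkJ
      exact (hnosink e he hkJ.2).elim
    · intro Z hZ hne hrZ
      obtain ⟨e, he, h1, h2⟩ := hcut Z (fun v hv => (hZ hv).1) hne hrZ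
      exact ⟨e, he, h1, ⟨hkmem e he, fun hJ => hnosink e he hJ.2⟩, h2⟩
    · intro e he f hf hmem heq
      refine hunique h e he f hf heq ?_
      change ind (h e) ≤ 1
      by_cases her : h e = r
      · rw [her]; omega
      · rcases hodd _ hmem.1 her with h1 | h1
        · exact h1.le
        · exact (hmem.2 ⟨hmem.1, h1⟩).elim
    · intro e he _ her
      have := hind_pos e he
      rw [her] at this
      omega
  · have hr1 : out r = 1 := by omega
    have hrout : ∀ e ∈ G.edgeSet, ∀ f ∈ G.edgeSet, k e = r → k f = r → e = f := by
      intro e he f hf h1 h2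
      refine hunique k e he f hf (h1.trans h2.symm) ?_
      change out (k e) ≤ 1
      rw [h1, hr1]
    have hVne : (G.vertexSet \ {r}).Nonempty := by
      refine Set.nonempty_of_ncard_ne_zero ?_
      have h1 := Set.ncard_sdiff_singleton_add_one hr hG.finite.1
      have h2 := hG.card_mod
      omega
    obtain ⟨e₁, he₁, ⟨hwV, hwr⟩, hk₁⟩ := hcut _ Set.sdiff_subset hVne (fun h => h.2 rfl)
    replace hk₁ : k e₁ = r := by_contra fun h' => hk₁ ⟨hkmem e₁ he₁, h'⟩
    replace hwr : h e₁ ≠ r := hwr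
    -- The only edge leaving `r` ends at `h e₁`. Were this a sink, nothing beyond these two vertices
    -- could be reached, and if there are no others, the edges entering `r` would have no possible
    -- tail.
    have hw3 : ind (h e₁) ≠ 3 := by
      intro hw3
      by_cases hne : (G.vertexSet \ {r, h e₁}).Nonempty
      · obtain ⟨e, he, h1, h2⟩ := hcut _ Set.sdiff_subset hne (fun h => h.2 (by simp))
        have h3 : k e = r ∨ k e = h e₁ := by
          by_contra h4
          exact h2 ⟨hkmem e he, by simpa using h4⟩
        rcases h3 with h3 | h3
        · exact h1.2 (by simp [hrout e he e₁ he₁ h3 hk₁])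
        · exact hnosink e he (h3 ▸ hw3)
      · rw [Set.not_nonempty_iff_eq_empty, Set.sdiff_eq_empty] at hne
        obtain ⟨e, he, her⟩ : {e | e ∈ G.edgeSet ∧ h e = r}.Nonempty :=
          Set.nonempty_of_ncard_ne_zero hr0
        rcases hne (hkmem e he) with h3 | h3
        · have := hrout e he e₁ he₁ h3 hk₁
          exact hwr (this ▸ her)
        · exact hnosink e he (h3 ▸ hw3)
    have hw1 : ind (h e₁) = 1 := (hodd _ hwV hwr).resolve_right hw3
    -- The new root `h e₁` has in-degree 1 and is entered only from `r`, so no edge from outside `J`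
    -- enters it.
    refine ⟨{v | v ∈ G.vertexSet ∧ (ind v = 3 ∨ v = r)}, h e₁, h, k, fun v hv => hv.1,
      ⟨hwV, ?_⟩, hk, ?_, ?_, ?_, ?_⟩
    · rintro ⟨-, h3 | h3⟩
      exacts [hw3 h3, hwr h3]
    · rintro e he ⟨-, h3 | h3⟩
      · exact (hnosink e he h3).elim
      · rw [hrout e he e₁ he₁ h3 hk₁]
        rintro ⟨-, h4 | h4⟩
        exacts [hw3 h4, hwr h4]
    · intro Z hZ hne hwZ
      obtain ⟨e, he, h1, h2⟩ := hcut Z (fun v hv => (hZ hv).1) hne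
        (fun h => (hZ h).2 ⟨hr, Or.inr rfl⟩)
      refine ⟨e, he, h1, ⟨hkmem e he, ?_⟩, h2⟩
      rintro ⟨-, h3 | h3⟩
      · exact hnosink e he h3
      · exact hwZ (hrout e he e₁ he₁ h3 hk₁ ▸ h1)
    · intro e he f hf hmem heq
      refine hunique h e he f hf heq ?_
      change ind (h e) ≤ 1
      have her : h e ≠ r := fun h1 => hmem.2 ⟨hmem.1, Or.inr h1⟩
      rcases hodd _ hmem.1 her with h1 | h1
      · exact h1.le
      · exact (hmem.2 ⟨hmem.1, Or.inl h1⟩).elim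
    · intro e he hkA hew
      have h1 : e₁ = e := hunique h e₁ he₁ e he hew.symm hw1.le
      exact hkA.2 ⟨hkA.1, Or.inr (h1 ▸ hk₁)⟩

end Orientation

namespace IsArborescenceOff

variable {J : Set α} {ρ : α} {h k : β → α}

theorem isConnected (hJ : G.IsArborescenceOff J ρ h k) :
    (G.induce (G.vertexSet \ J)).IsConnected := by
  refine isConnected_of_forall_exists_adj hJ.root_mem fun Z hZ hne hρ => ?_
  obtain ⟨e, he, h1, h2⟩ := hJ.entered Z hZ hne hρ
  exact ⟨h e, k e, ⟨e, (hJ.isLink e he).symm, hZ h1, h2.1⟩, h1, h2.2⟩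

/-- Count the edges from outside `J` whose heads lie on a cycle `C`: at most one per vertex of `C`
and none at `ρ`. If `ρ` is on `C`, these are too few for the edges of `C`; if not, an edge entering
`C` from elsewhere makes them too many. -/
theorem isForest (hJ : G.IsArborescenceOff J ρ h k) (hG : G.IsFinite) :
    (G.induce (G.vertexSet \ J)).IsForest := by
  rintro ⟨C, hC, hCcyc⟩
  have hZ : C.vertexSet ⊆ G.vertexSet \ J := hC.vertexSet_mono
  set F : Set β := {e | e ∈ G.edgeSet ∧ h e ∈ C.vertexSet ∧ k e ∈ G.vertexSet \ J} with hF
  have hFfin : F.Finite := hG.2.subset fun e he => he.1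
  have hends : ∀ e ∈ C.edgeSet, e ∈ G.edgeSet ∧ h e ∈ C.vertexSet ∧ k e ∈ C.vertexSet := by
    intro e he
    obtain ⟨x, y, hxy⟩ := exists_isLink_of_mem_edgeSet he
    have h1 : G.IsLink e x y := (hC.isLink_mono hxy).1
    refine ⟨h1.edge_mem, ?_⟩
    rcases (hJ.isLink e h1.edge_mem).eq_and_eq_or_eq_and_eq h1 with ⟨h2, h3⟩ | ⟨h2, h3⟩ <;>
      rw [h2, h3]
    exacts [⟨hxy.right_mem, hxy.left_mem⟩, ⟨hxy.left_mem, hxy.right_mem⟩]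
  have hsub : C.edgeSet ⊆ F := fun e he =>
    ⟨(hends e he).1, (hends e he).2.1, hZ (hends e he).2.2⟩
  have hle : F.ncard ≤ (C.vertexSet \ {ρ}).ncard := by
    refine Set.ncard_le_ncard_of_injOn h (fun e he => ⟨he.2.1, hJ.ne_root e he.1 he.2.2⟩) ?_
      (hCcyc.1.1.subset Set.sdiff_subset)
    intro e he f hf hef
    exact hJ.injOn e he.1 f hf.1 (hZ he.2.1) hef
  have hcard := hCcyc.ncard_edgeSet
  have h1 := Set.ncard_le_ncard hsub hFfin
  by_cases hρ : ρ ∈ C.vertexSet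
  · have h2 := Set.ncard_sdiff_singleton_add_one hρ hCcyc.1.1
    omega
  · obtain ⟨e, he, h2, h3⟩ := hJ.entered _ hZ hCcyc.2.1.1 hρ
    have h4 : e ∉ C.edgeSet := fun he' => h3.2 (hends e he').2.2
    have h5 := Set.ncard_lt_ncard (hsub.ssubset_of_mem_notMem (a := e) ⟨he, h2, h3.1⟩ h4) hFfin
    rw [Set.sdiff_singleton_eq_self hρ] at hle
    omega

theorem ncard_le (hJ : G.IsArborescenceOff J ρ h k) (hG : G.IsFinite) :
    (G.vertexSet \ J).ncard ≤ (G.induce (G.vertexSet \ J)).edgeSet.ncard + 1 := by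
  have h1 : ∀ v ∈ (G.vertexSet \ J) \ {ρ}, ∃ e ∈ (G.induce (G.vertexSet \ J)).edgeSet,
      h e = v := by
    intro v hv
    obtain ⟨e, he, h1, h2⟩ := hJ.entered {v} (by simpa using hv.1) (by simp)
      (fun h => hv.2 h.symm)
    exact ⟨e, ⟨_, _, hJ.isLink e he, h2.1, h1 ▸ hv.1⟩, h1⟩
  have h2 : (G.vertexSet \ J) \ {ρ} ⊆ h '' (G.induce (G.vertexSet \ J)).edgeSet := h1
  have hfin : (G.induce (G.vertexSet \ J)).edgeSet.Finite :=
    hG.2.subset (edgeSet_induce_subset G _)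
  have h3 := Set.ncard_le_ncard h2 (hfin.image h)
  have h4 := Set.ncard_image_le (f := h) hfin
  have h5 := Set.ncard_sdiff_singleton_add_one hJ.root_mem (hG.1.subset Set.sdiff_subset)
  omega

theorem isIndependent (hJ : G.IsArborescenceOff J ρ h k) : G.IsIndependent J := by
  rw [IsIndependent, Set.eq_empty_iff_forall_notMem]
  rintro e ⟨x, y, hxy, hx, hy⟩
  have h1 := hJ.independent e hxy.edge_mem
  rcases (hJ.isLink e hxy.edge_mem).eq_and_eq_or_eq_and_eq hxy with ⟨h2, h3⟩ | ⟨h2, h3⟩ <;>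
    rw [h2, h3] at h1
  exacts [h1 hx hy, h1 hy hx]

end IsArborescenceOff

/-- A decycling set of a finite cubic graph on `n` vertices has at least `(n + 2) / 4` elements. -/
theorem IsCubic.ncard_add_two_le_of_isDecyclingSet (hcubic : G.IsCubic) (hG : G.IsFinite)
    (hne : G.vertexSet.Nonempty) {J : Set α} (hJ : G.IsDecyclingSet J) :
    G.vertexSet.ncard + 2 ≤ 4 * J.ncard := by
  have h1 := Set.ncard_sdiff_add_ncard_of_subset hJ.1 hG.1
  have h2 := (Set.ncard_pos hG.1).2 hne
  rcases (G.vertexSet \ J).eq_empty_or_nonempty with h3 | h3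
  · rw [h3, Set.ncard_empty] at h1
    omega
  · have h4 : (G.induce (G.vertexSet \ J)).IsForest := hJ.2
    have h5 : (G.induce (G.vertexSet \ J)).edgeSet.ncard < (G.vertexSet \ J).ncard :=
      h4.ncard_lt (hG.mono (induce_le Set.sdiff_subset)) h3
    -- A forest on `a` vertices sends at least `3 a - 2 (a - 1) = a + 2` edges to `J`, which
    -- receives at most `3 |J|`.
    have h6 := hcubic.two_mul_ncard_add hG hJ.1
    have h7 := hcubic.two_mul_ncard_add hG (X := G.vertexSet \ J) Set.sdiff_subset
    rw [edgeCut_diff] at h7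
    omega

theorem IsConnected.encard_setOf_isComponent_le (hG : G.IsConnected) :
    {C : Set α | G.IsComponent C}.encard ≤ 1 := by
  refine (Set.encard_le_encard (t := {G.vertexSet}) ?_).trans (by simp)
  rintro C ⟨x, hx, rfl⟩
  rw [Set.mem_singleton_iff]
  ext y
  exact ⟨fun h => Reaches.mem_of_closed h (fun u v huv _ => huv.right_mem) hx,
    fun hy => hG.2 x hx y hy⟩

theorem IsEvenCubic.exists_isCoherentDecyclingPartition (hG : G.IsEvenCubic) :
    ∃ A J : Set α, G.IsCoherentDecyclingPartition A J ∧
      (G.induce A).IsTree ∧ G.IsIndependent J := by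
  obtain ⟨J, ρ, h, k, hJ⟩ := hG.exists_isArborescenceOff
  have hfor := hJ.isForest hG.finite
  have hconn := hJ.isConnected
  have hind := hJ.isIndependent
  have hJfin := hG.finite.1.subset hJ.subset
  have h1 := Set.ncard_sdiff_add_ncard_of_subset hJ.subset hG.finite.1
  have h2 := hG.cubic.two_mul_ncard_add hG.finite hJ.subset
  have h3 := hG.cubic.two_mul_ncard_add hG.finite (X := G.vertexSet \ J) Set.sdiff_subset
  rw [edgeCut_diff] at h3
  have h4 := hJ.ncard_le hG.finite
  have h5 : (G.induce J).edgeSet.ncard = 0 := by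
    rw [show (G.induce J).edgeSet = ∅ from hind, Set.ncard_empty]
  have hdec : G.IsDecyclingSet J := ⟨hJ.subset, hfor⟩
  have hVne : G.vertexSet.Nonempty := ⟨ρ, hJ.root_mem.1⟩
  have hJne : J.Nonempty := by
    refine Set.nonempty_of_ncard_ne_zero ?_
    have := hG.cubic.ncard_add_two_le_of_isDecyclingSet hG.finite hVne hdec
    omega
  -- As `J` is independent and its complement is a tree, the degree count gives `4 |J| = |V| + 2`,
  -- the lower bound for every decycling set.
  have hmin : G.IsMinimumDecyclingSet J := by
    refine ⟨hdec, fun J' hJ' => ?_⟩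
    have h6 := hG.cubic.ncard_add_two_le_of_isDecyclingSet hG.finite hVne hJ'
    rw [← hJfin.cast_ncard_eq, ← (hG.finite.1.subset hJ'.1).cast_ncard_eq]
    have h7 : J.ncard ≤ J'.ncard := by omega
    exact_mod_cast h7
  refine ⟨G.vertexSet \ J, J, ⟨⟨Set.sdiff_union_of_subset hJ.subset, Set.disjoint_sdiff_left,
    ⟨ρ, hJ.root_mem⟩, hJne, hmin, Or.inl hind, hfor, ?_⟩, hconn, hfor⟩, ⟨hconn, hfor⟩, hind⟩
  exact hconn.encard_setOf_isComponent_le.trans (by norm_num)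

end Graph

theorem theorem6p3 {α β : Type*} (G : Graph α β) (hfin : G.IsFinite) (hcubic : G.IsCubic)
    (hodd : G.OddCyclicallyConnected 4) (hconn : G.cyclicConnectivity = 3)
    (hK4 : ¬ G.IsK4) :
    (∃ L : Multiset (Graph α β), G.IsCanonicalDecomposition L) ∧
    (∀ L : Multiset (Graph α β), G.IsCanonicalDecomposition L →
      ∀ K ∈ L, Even K.bettiNumber) ∧
    Even G.bettiNumber ∧
    ∃ A J : Set α, G.IsCoherentDecyclingPartition A J ∧
      (G.induce A).IsTree ∧ G.IsIndependent J := by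
  have hG := Graph.isEvenCubic_of_oddCyclicallyConnected hfin hcubic hodd hconn hK4
  exact ⟨Graph.IsEvenCubic.exists_isCanonicalDecomposition _ G hG rfl,
    fun L hL K hK => (hL.isEvenCubic hG K hK).even_bettiNumber, hG.even_bettiNumber,
    hG.exists_isCoherentDecyclingPartition⟩
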